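/- Let $K$ be a field and $R=K[x_1,\dots,x_n]$. For a monomial ideal $I\subseteq R$ let $G(I)$ denote its unique minimal set of monomial generators. For a simplicial complex $\Delta$ on the vertex set $\{1,\dots,r\}$ (every $\{j\}$ is a face, and $\emptyset$ is a face) let $\mathcal C(\Delta)$ be its augmented chain complex over $K$, with basis $e_\sigma$, $\sigma\in\Delta$, where $e_\sigma$ is placed in homological degree $|\sigma|$, and $\partial e_\sigma=\sum_{j\in\sigma}\mathrm{sign}(j,\sigma)\,e_{\sigma\setminus j}$, where $\mathrm{sign}(j,\sigma)=(-1)^{t-1}$ if $j$ is the $t$-th element of $\sigma$ in increasing order. For monomials $m_1,\dots,m_r$, the $\{m_1,\dots,m_r\}$-homogenization of $\mathcal C(\Delta)$ is the multigraded complex of free $R$-modules with the same basis, whose multidegrees are defined inductively by $\mathrm{mdeg}(e_\emptyset)=1$, $\mathrm{mdeg}(e_{\{j\}})=m_j$ and, for $|\sigma|\ge 2$, $\mathrm{mdeg}(e_\sigma)=\mathrm{lcm}(\mathrm{mdeg}(e_\tau)\mid e_\tau\text{ occurs in }\partial e_\sigma)$, and whose differential is $d(e_\sigma)=\sum_{j\in\sigma}\mathrm{sign}(j,\sigma)\frac{\mathrm{mdeg}(e_\sigma)}{\mathrm{mdeg}(e_{\sigma\setminus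 j})}e_{\sigma\setminus j}$. If $G(I)=\{m_1,\dots,m_r\}$ with $|G(I)|=r$, the minimal free resolution of $I$ is said to be supported by $\Delta$ (with vertex $j$ labelled by $m_j$) if the multigraded minimal free resolution $\cdots\to F_1\to F_0=R\to R/I\to 0$ is isomorphic, as a multigraded complex, to the $G(I)$-homogenization of $\mathcal C(\Delta)$. Theorem. Let $I$ and $J$ be monomial ideals of $R$ with $I\cap J=IJ$, let $G(I)=\{m_1,\dots,m_r\}$ and $G(J)=\{m'_1,\dots,m'_s\}$ with $|G(I)|=r$ and $|G(J)|=s$, and suppose that the minimal free resolutions of $I$ and $J$ are supported by simplicial complexes $\Delta_I$ and $\Delta_J$ on the vertex sets $\{1,\dots,r\}$ and $\{r+1,\dots,r+s\}$ respectively (vertex $r+j$ being labelled by $m'_j$). Let $\Delta_I*\Delta_J=\{\sigma\cup\tau\mid\sigma\in\Delta_I,\ \tau\in\Delta_J\}$ be the join, a simplicial complex on $\{1,\dots,r+s\}$. Then $m_1,\dots,m_r,m'_1,\dots,m'_s$ are distinct and form $G(I+J)$, and the minimal free resolution of $I+J$ is supported by $\Delta_I*\Delta_J$ with this labelling. Moreover,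 $\mathcal C(\Delta_I)\otimes_K\mathcal C(\Delta_J)\cong\mathcal C(\Delta_I*\Delta_J)$ as chain complexes of $K$-vector spaces. -/

import Mathlib

open CategoryTheory MvPolynomial

noncomputable section

namespace MonRes

universe u

/-! ### Monomial ideals

A monomial `x₁^{a₁} ⋯ xₙ^{aₙ}` is represented by its exponent vector `a : Fin n →₀ ℕ`, so that
divisibility is `≤`, the least common multiple is `⊔`, the monomial `1` is `0`. -/

/-- The ideal generated by the monomials with exponents in `S`. -/
def monomialSpan (K : Type u) [Field K] {n : ℕ} (S : Set (Fin n →₀ ℕ)) :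
    Ideal (MvPolynomial (Fin n) K) :=
  Ideal.span ((fun a => monomial a (1 : K)) '' S)

/-- `m₁, …, mᵣ` are `r` distinct monomials that form the minimal monomial generating set `G(I)` of
`I`: they generate `I`, and no proper subset of them does. (So `I` is a monomial ideal and
`|G(I)| = r`.) -/
structure IsMinimalMonomialGenerators {K : Type u} [Field K] {n r : ℕ}
    (I : Ideal (MvPolynomial (Fin n) K)) (m : Fin r → (Fin n →₀ ℕ)) : Prop where
  injective : Function.Injective m
  span_eq : monomialSpan K (Set.range m) = I
  minimal : ∀ S : Set (Fin n →₀ ℕ), S ⊂ Set.range m → monomialSpan K S ≠ I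

/-! ### Complexes of finite free modules given by matrices -/

/-- The linear map between free modules sending the basis vector `e_b` to `∑ c, A b c • e_c`. -/
def matrixMap {R : Type u} [CommRing R] {B C : Type} [Fintype C] (A : B → C → R) :
    (B →₀ R) →ₗ[R] (C →₀ R) :=
  Finsupp.linearCombination R (fun b => ∑ c, Finsupp.single c (A b c))

theorem matrixMap_comp {R : Type u} [CommRing R] {B C D : Type} [Fintype C] [Fintype D]
    (A : B → C → R) (A' : C → D → R) (h : ∀ b d, ∑ c, A b c * A' c d = 0) :
    matrixMap A' ∘ₗ matrixMap A = 0 := by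
  ext b d
  classical
  have := h b d
  simp [matrixMap, Finsupp.linearCombination_single, map_sum, Finsupp.finsetSum_apply,
    Finsupp.single_apply]
  exact this

/-- The chain complex with `X i` the free module on `B i` and with differential
`e_b ↦ ∑ c, A i b c • e_c`. -/
def matrixComplex {R : Type u} [CommRing R] (B : ℕ → Type) [∀ i, Fintype (B i)]
    (A : ∀ i, B (i + 1) → B i → R)
    (h : ∀ i b d, ∑ c, A (i + 1) b c * A i c d = 0) : ChainComplex (ModuleCat.{u} R) ℕ :=
  ChainComplex.of (fun i => ModuleCat.of R (B i →₀ R))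
    (fun i => ModuleCat.ofHom (matrixMap (A i)))
    (fun i => by
      rw [← ModuleCat.ofHom_comp, matrixMap_comp _ _ (h i)]
      rfl)

/-! ### Multigraded complexes of free modules and minimal free resolutions -/

/-- A multigraded (`ℤⁿ`-graded, with generators in `ℕⁿ`) complex of finitely generated free
multigraded modules over `K[x₁, …, xₙ]` with a fixed multihomogeneous basis: `gens i` is the basis
in homological degree `i`, `mdeg` the multidegrees of the basis elements, `coeff` the matrices of
the differentials, whose entries are homogeneous of the degree that makes the differential
homogeneous of degree `0`. -/
structure MultigradedComplex (K : Type u) [Field K] (n : ℕ) where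
  gens : ℕ → Type
  fintypeGens : ∀ i, Fintype (gens i)
  mdeg : ∀ i, gens i → (Fin n →₀ ℕ)
  coeff : ∀ i, gens (i + 1) → gens i → MvPolynomial (Fin n) K
  coeff_comp : ∀ i v w, ∑ u, coeff (i + 1) v u * coeff i u w = 0
  coeff_homogeneous : ∀ i v u, ∀ c ∈ (coeff i v u).support, c + mdeg i u = mdeg (i + 1) v

namespace MultigradedComplex

attribute [instance] MultigradedComplex.fintypeGens

variable {K : Type u} [Field K] {n : ℕ}

/-- The underlying chain complex of modules over the polynomial ring. -/
def complex (F : MultigradedComplex K n) :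
    ChainComplex (ModuleCat.{u} (MvPolynomial (Fin n) K)) ℕ :=
  matrixComplex F.gens F.coeff F.coeff_comp

/-- The `i`-th free module of the complex. -/
abbrev FreeModule (F : MultigradedComplex K n) (i : ℕ) : Type u :=
  F.gens i →₀ MvPolynomial (Fin n) K

/-- The `i`-th differential, from homological degree `i + 1` to `i`. -/
def d (F : MultigradedComplex K n) (i : ℕ) :
    F.FreeModule (i + 1) →ₗ[MvPolynomial (Fin n) K] F.FreeModule i :=
  matrixMap (F.coeff i)

/-- `x` lies in the component of multidegree `a`: every term `x^c e_b` that occurs in `x`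
has multidegree `c + mdeg b = a`. -/
def IsHomogeneous (F : MultigradedComplex K n) (i : ℕ) (a : Fin n →₀ ℕ) (x : F.FreeModule i) : Prop :=
  ∀ b, ∀ c ∈ (x b).support, c + F.mdeg i b = a

/-- `F` and `G` are isomorphic as multigraded complexes: there is an isomorphism of the underlying
complexes that, together with its inverse, is homogeneous of degree `0`. -/
def IsIsomorphic (F G : MultigradedComplex K n) : Prop :=
  ∃ e : F.complex ≅ G.complex,
    (∀ i a (x : F.FreeModule i), F.IsHomogeneous i a x → G.IsHomogeneous i a ((e.hom.f i).hom x)) ∧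
    (∀ i a (y : G.FreeModule i), G.IsHomogeneous i a y → F.IsHomogeneous i a ((e.inv.f i).hom y))

/-- `F` is a multigraded minimal free resolution of `I`, in the form `⋯ → F₁ → F₀ → R/I → 0`. -/
structure IsMinimalFreeResolution (F : MultigradedComplex K n)
    (I : Ideal (MvPolynomial (Fin n) K)) : Prop where
  /-- Exactness in positive homological degrees. -/
  exact : ∀ i, Function.Exact (F.d (i + 1)) (F.d i)
  /-- A homogeneous surjection `F₀ → R/I` whose kernel is the image of `F₁`. -/
  augmentation : ∃ ε : F.FreeModule 0 →ₗ[MvPolynomial (Fin n) K] (MvPolynomial (Fin n) K ⧸ I),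
    Function.Surjective ε ∧ Function.Exact (F.d 0) ε ∧
    ∀ a x, F.IsHomogeneous 0 a x → ∃ c : K, ε x = Ideal.Quotient.mk I (monomial a c)
  /-- Minimality: the image of each differential lies in `(x₁, …, xₙ)` times the free module. -/
  minimal : ∀ i, LinearMap.range (F.d i) ≤
    Ideal.span (Set.range (X : Fin n → MvPolynomial (Fin n) K)) • (⊤ : Submodule _ (F.FreeModule i))

end MultigradedComplex

/-! ### Frames and their homogenizations -/

/-- An `r`-frame over `K`: a complex of finite-dimensional vector spaces with a fixed basis
(`basis i` in homological degree `i`, `coeff` the matrices of the differentials), with `U₀ = K`,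
`U₁ = K^r` and `∂ w = 1` for each basis vector `w` of `U₁`. -/
structure Frame (K : Type u) [Field K] (r : ℕ) where
  basis : ℕ → Type
  fintypeBasis : ∀ i, Fintype (basis i)
  coeff : ∀ i, basis (i + 1) → basis i → K
  coeff_comp : ∀ i v w, ∑ u, coeff (i + 1) v u * coeff i u w = 0
  basisZero : basis 0 ≃ Unit
  basisOne : basis 1 ≃ Fin r
  coeff_zero : ∀ v w, coeff 0 v w = 1

namespace Frame

attribute [instance] Frame.fintypeBasis

variable {K : Type u} [Field K] {n r : ℕ}

/-- The complex of vector spaces underlying a frame. -/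
def complex (U : Frame K r) : ChainComplex (ModuleCat.{u} K) ℕ :=
  matrixComplex U.basis U.coeff U.coeff_comp

open Classical in
/-- The multidegrees of the basis elements of the `M`-homogenization, `M = {m₁, …, mᵣ}`:
`0` in homological degree `0`, `mⱼ` for the `j`-th basis element in homological degree `1`, and
`lcm (mdeg u ∣ u occurs in ∂ v)` for a basis element `v` in higher degree, with `lcm ∅ = 1`. -/
def mdeg (U : Frame K r) (m : Fin r → (Fin n →₀ ℕ)) : ∀ i, U.basis i → (Fin n →₀ ℕ)
  | 0, _ => 0
  | 1, v => m (U.basisOne v)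
  | i + 2, v => (Finset.univ.filter (fun u => U.coeff (i + 1) v u ≠ 0)).sup (U.mdeg m (i + 1))

theorem mdeg_le (U : Frame K r) (m : Fin r → (Fin n →₀ ℕ)) (i : ℕ) (v : U.basis (i + 1))
    (u : U.basis i) (h : U.coeff i v u ≠ 0) : U.mdeg m i u ≤ U.mdeg m (i + 1) v := by
  classical
  cases i with
  | zero => simp [mdeg]
  | succ i =>
    rw [mdeg]
    exact Finset.le_sup (f := U.mdeg m (i + 1)) (by simpa using h)

/-- The `M`-homogenization of a frame: the differential is
`d v = ∑ u, α_{uv} (mdeg v / mdeg u) u` when `∂ v = ∑ u, α_{uv} u` in the frame. -/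
def homogenization (U : Frame K r) (m : Fin r → (Fin n →₀ ℕ)) : MultigradedComplex K n where
  gens := U.basis
  fintypeGens := U.fintypeBasis
  mdeg := U.mdeg m
  coeff i v u := monomial (U.mdeg m (i + 1) v - U.mdeg m i u) (U.coeff i v u)
  coeff_comp i v w := by
    have key : ∀ u, monomial (U.mdeg m (i + 1 + 1) v - U.mdeg m (i + 1) u) (U.coeff (i + 1) v u) *
        monomial (U.mdeg m (i + 1) u - U.mdeg m i w) (U.coeff i u w) =
        monomial (U.mdeg m (i + 1 + 1) v - U.mdeg m i w)
          (U.coeff (i + 1) v u * U.coeff i u w) := by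
      intro u
      rw [monomial_mul]
      by_cases h1 : U.coeff (i + 1) v u = 0
      · simp [h1]
      by_cases h2 : U.coeff i u w = 0
      · simp [h2]
      rw [tsub_add_tsub_cancel (U.mdeg_le m _ _ _ h1) (U.mdeg_le m _ _ _ h2)]
    rw [Finset.sum_congr rfl (fun u _ => key u), ← map_sum, U.coeff_comp, map_zero]
  coeff_homogeneous i v u c hc := by
    classical
    have h0 : U.coeff i v u ≠ 0 := by
      intro h
      simp [h] at hc
    rw [support_monomial, if_neg h0, Finset.mem_singleton] at hc
    rw [hc, tsub_add_cancel_of_le (U.mdeg_le m _ _ _ h0)]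

end Frame

/-! ### Simplicial complexes

A simplicial complex on the vertex set `{1, …, r}` is an `AbstractSimplicialComplex (Fin r)`; its
`faces` are the nonempty faces. The empty set counts as a face (of dimension `-1`) here. -/

/-- All faces of a simplicial complex, the empty face included. -/
def allFaces {r : ℕ} (Δ : AbstractSimplicialComplex (Fin r)) : Set (Finset (Fin r)) :=
  insert ∅ Δ.faces

theorem allFaces_mono {r : ℕ} (Δ : AbstractSimplicialComplex (Fin r)) {σ τ : Finset (Fin r)}
    (hσ : σ ∈ allFaces Δ) (h : τ ⊆ σ) : τ ∈ allFaces Δ := by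
  rcases Finset.eq_empty_or_nonempty τ with rfl | hτ
  · exact Or.inl rfl
  rcases hσ with rfl | hσ
  · exact absurd (Finset.subset_empty.mp h) hτ.ne_empty
  · exact Or.inr ((Δ.isRelLowerSet_faces hσ).2 h hτ)

/-- The join of simplicial complexes on the disjoint vertex sets `{1, …, r}` and
`{r + 1, …, r + s}`: its faces are the unions of a face of the first and a face of the second. -/
def join {r s : ℕ} (Δ₁ : AbstractSimplicialComplex (Fin r))
    (Δ₂ : AbstractSimplicialComplex (Fin s)) : AbstractSimplicialComplex (Fin (r + s)) where
  faces := {ρ | ρ.Nonempty ∧ ∃ σ ∈ allFaces Δ₁, ∃ τ ∈ allFaces Δ₂,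
    ρ = σ.map (Fin.castAddEmb s) ∪ τ.map (Fin.natAddEmb r)}
  isRelLowerSet_faces := by
    rintro ρ ⟨hρ, σ, hσ, τ, hτ, rfl⟩
    refine ⟨hρ, ?_⟩
    intro ρ' hsub hne
    refine ⟨hne, σ.filter (fun i => Fin.castAddEmb s i ∈ ρ'),
      allFaces_mono _ hσ (Finset.filter_subset _ _),
      τ.filter (fun i => Fin.natAddEmb r i ∈ ρ'),
      allFaces_mono _ hτ (Finset.filter_subset _ _), ?_⟩
    ext x
    simp only [Finset.mem_union, Finset.mem_map, Finset.mem_filter]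
    constructor
    · intro hx
      rcases Finset.mem_union.mp (hsub hx) with h | h
      · obtain ⟨y, hy, rfl⟩ := Finset.mem_map.mp h
        exact Or.inl ⟨y, ⟨hy, hx⟩, rfl⟩
      · obtain ⟨y, hy, rfl⟩ := Finset.mem_map.mp h
        exact Or.inr ⟨y, ⟨hy, hx⟩, rfl⟩
    · rintro (⟨y, ⟨-, hy⟩, rfl⟩ | ⟨y, ⟨-, hy⟩, rfl⟩) <;> exact hy
  singleton_mem v := by
    refine ⟨Finset.singleton_nonempty v, ?_⟩
    induction v using Fin.addCases with
    | left i => exact ⟨{i}, Or.inr (Δ₁.singleton_mem i), ∅, Or.inl rfl, by simp⟩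
    | right i => exact ⟨∅, Or.inl rfl, {i}, Or.inr (Δ₂.singleton_mem i), by simp⟩

/-- The faces with `i` elements, that is, of dimension `i - 1`. -/
abbrev FacesOfCard {r : ℕ} (Δ : AbstractSimplicialComplex (Fin r)) (i : ℕ) : Type :=
  {σ : Finset (Fin r) // σ ∈ allFaces Δ ∧ σ.card = i}

instance {r : ℕ} (Δ : AbstractSimplicialComplex (Fin r)) (i : ℕ) : Fintype (FacesOfCard Δ i) :=
  Fintype.ofFinite _

/-- `sign(j, σ) = (-1)^{t - 1}` when `j` is the `t`-th element of `σ` in increasing order. -/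
def sign (K : Type u) [Field K] {r : ℕ} (j : Fin r) (σ : Finset (Fin r)) : K :=
  (-1) ^ (σ.filter (fun k => k < j)).card

/-- The coefficient of `e_τ` in `∂ e_σ = ∑ j ∈ σ, sign(j, σ) e_{σ - j}`. -/
def boundaryCoeff (K : Type u) [Field K] {r : ℕ} (σ τ : Finset (Fin r)) : K :=
  ∑ j ∈ σ, if τ = σ.erase j then sign K j σ else 0

theorem sign_antisymm (K : Type u) [Field K] {r : ℕ} {σ : Finset (Fin r)} {j k : Fin r}
    (hj : j ∈ σ) (hjk : j < k) :
    sign K j σ * sign K k (σ.erase j) + sign K k σ * sign K j (σ.erase k) = 0 := by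
  have h1 : (σ.erase k).filter (fun l => l < j) = σ.filter (fun l => l < j) := by
    ext l
    simp only [Finset.mem_filter, Finset.mem_erase]
    constructor
    · rintro ⟨⟨-, h⟩, h'⟩
      exact ⟨h, h'⟩
    · rintro ⟨h, h'⟩
      exact ⟨⟨(h'.trans hjk).ne, h⟩, h'⟩
  have h2 : σ.filter (fun l => l < k) = insert j ((σ.erase j).filter (fun l => l < k)) := by
    ext l
    simp only [Finset.mem_filter, Finset.mem_erase, Finset.mem_insert]
    by_cases hl : l = j
    · subst hl
      simp [hj, hjk]
    · simp [hl]
  rw [sign, sign, sign, sign, h1, h2, Finset.card_insert_of_notMem (by simp), pow_succ]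
  ring

theorem boundaryCoeff_comp (K : Type u) [Field K] {r : ℕ} (Δ : AbstractSimplicialComplex (Fin r))
    {i : ℕ} (σ : FacesOfCard Δ (i + 1 + 1)) (τ : FacesOfCard Δ i) :
    ∑ ρ : FacesOfCard Δ (i + 1), boundaryCoeff K σ.1 ρ.1 * boundaryCoeff K ρ.1 τ.1 = 0 := by
  have h1 : ∑ ρ : FacesOfCard Δ (i + 1), boundaryCoeff K σ.1 ρ.1 * boundaryCoeff K ρ.1 τ.1 =
      ∑ j ∈ σ.1, sign K j σ.1 * boundaryCoeff K (σ.1.erase j) τ.1 := by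
    have h2 : ∀ ρ : FacesOfCard Δ (i + 1),
        boundaryCoeff K σ.1 ρ.1 * boundaryCoeff K ρ.1 τ.1 =
        ∑ j ∈ σ.1, if ρ.1 = σ.1.erase j then
          sign K j σ.1 * boundaryCoeff K (σ.1.erase j) τ.1 else 0 := by
      intro ρ
      rw [boundaryCoeff, Finset.sum_mul]
      refine Finset.sum_congr rfl fun j _ => ?_
      split_ifs with h
      · rw [h]
      · rw [zero_mul]
    rw [Finset.sum_congr rfl (fun ρ _ => h2 ρ), Finset.sum_comm]
    refine Finset.sum_congr rfl fun j hj => ?_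
    rw [Finset.sum_eq_single (⟨σ.1.erase j, allFaces_mono Δ σ.2.1 (Finset.erase_subset _ _), by
      rw [Finset.card_erase_of_mem hj, σ.2.2]; rfl⟩ : FacesOfCard Δ (i + 1))]
    · rw [if_pos rfl]
    · intro ρ _ hρ
      rw [if_neg]
      exact fun h => hρ (Subtype.ext h)
    · exact fun h => absurd (Finset.mem_univ _) h
  rw [h1]
  simp only [boundaryCoeff, Finset.mul_sum]
  rw [Finset.sum_sigma']
  refine Finset.sum_involution (fun p _ => ⟨p.2, p.1⟩) ?_ ?_ ?_ ?_
  · rintro ⟨j, k⟩ h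
    simp only [Finset.mem_sigma, Finset.mem_erase] at h
    obtain ⟨hj, hkj, hk⟩ := h
    simp only [Finset.erase_right_comm (a := k) (b := j)]
    split_ifs with hτ
    · rcases lt_or_gt_of_ne hkj with hlt | hlt
      · rw [add_comm]
        exact sign_antisymm K hk hlt
      · exact sign_antisymm K hj hlt
    · simp
  · rintro ⟨j, k⟩ h _ heq
    simp only [Finset.mem_sigma, Finset.mem_erase] at h
    simp only [Sigma.mk.injEq, heq_eq_eq] at heq
    exact h.2.1 heq.1
  · rintro ⟨j, k⟩ h
    simp only [Finset.mem_sigma, Finset.mem_erase] at h ⊢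
    exact ⟨h.2.2, h.2.1.symm, h.1⟩
  · rintro ⟨j, k⟩ _
    rfl

/-- The frame of a simplicial complex: its (augmented) chain complex over `K`, with the faces with
`i` elements as the basis in homological degree `i`. -/
def simplicialFrame (K : Type u) [Field K] {r : ℕ} (Δ : AbstractSimplicialComplex (Fin r)) :
    Frame K r where
  basis i := FacesOfCard Δ i
  fintypeBasis := inferInstance
  coeff _ σ τ := boundaryCoeff K σ.1 τ.1
  coeff_comp i σ τ := boundaryCoeff_comp K Δ σ τ
  basisZero :=
    { toFun := fun _ => ()
      invFun := fun _ => ⟨∅, Or.inl rfl, rfl⟩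
      left_inv := fun σ => Subtype.ext (Finset.card_eq_zero.mp σ.2.2).symm
      right_inv := fun _ => rfl }
  basisOne := (Equiv.ofBijective
    (fun j : Fin r => (⟨{j}, Or.inr (Δ.singleton_mem j), Finset.card_singleton j⟩ :
      FacesOfCard Δ 1))
    ⟨fun a b h => Finset.singleton_injective (congrArg Subtype.val h), fun σ => by
      obtain ⟨j, hj⟩ := Finset.card_eq_one.mp σ.2.2
      exact ⟨j, Subtype.ext hj.symm⟩⟩).symm
  coeff_zero σ τ := by
    obtain ⟨j, hj⟩ := Finset.card_eq_one.mp σ.2.2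
    have ht : τ.1 = ∅ := Finset.card_eq_zero.mp τ.2.2
    simp [boundaryCoeff, sign, hj, ht, Finset.filter_singleton]

/-- The chain complex `C(Δ)` of a simplicial complex over `K`, with the faces of dimension `i - 1`
in homological degree `i`. -/
abbrev chainComplex (K : Type u) [Field K] {r : ℕ} (Δ : AbstractSimplicialComplex (Fin r)) :
    ChainComplex (ModuleCat.{u} K) ℕ :=
  (simplicialFrame K Δ).complex

/-! ### Simplicially supported resolutions -/

/-- `G(I) = {m₁, …, mᵣ}`, and a minimal free resolution of `I` is supported by the simplicial
complex `Δ` on the vertex set `{1, …, r}`, the vertex `j` carrying the label `mⱼ`: it is isomorphic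
to the `G(I)`-homogenization of the chain complex of `Δ`. -/
def MinimalResolutionSupportedBy {K : Type u} [Field K] {n r : ℕ}
    (I : Ideal (MvPolynomial (Fin n) K)) (m : Fin r → (Fin n →₀ ℕ))
    (Δ : AbstractSimplicialComplex (Fin r)) : Prop :=
  IsMinimalMonomialGenerators I m ∧
    ∃ F : MultigradedComplex K n, F.IsMinimalFreeResolution I ∧
      F.IsIsomorphic ((simplicialFrame K Δ).homogenization m)

end MonRes

end

noncomputable section

namespace MonRes

universe u

/-! Everything reduces to one combinatorial criterion, `minimalResolutionSupportedBy_iff`. The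
homogenization of a simplicial frame splits by multidegree, and its strand in multidegree `a` is the
augmented chain complex over `K` of the subcomplex of faces whose label divides `a`. So `Δ` supports
a minimal free resolution of `I` exactly when the labels form `G(I)`, every such strand is exact in
positive homological degrees, and no face has the same label as one of its facets.

Exactness passes to joins without any coprimality. The label of `σ ∪ τ` is the lcm of the labels of
`σ` and `τ`, so the faces of the join below `a` are the join of the faces of `ΔI` and of `ΔJ` below
`a`. If some vertex of one factor lies below `a`, the strand of that factor is exact in homological
degree `0` too, and a join with an acyclic factor is acyclic (`Acyclic.join_left`,
`Acyclic.join_right`). If no vertex lies below `a`, only the empty face does, and there is nothing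
to prove in positive degrees.

The equality `I ∩ J = IJ` enters through `disjoint_of_inf_eq_mul`: it makes each generator of `I`
coprime to each generator of `J`. Then neither set of generators makes a member of the other
redundant, and deleting a vertex of `σ` from `σ ∪ τ` changes the label because it already changes
the label of `σ`, whose variables do not occur in the label of `τ`.

The isomorphism of chain complexes is `e_σ ⊗ e_τ ↦ e_{σ ∪ τ}`. The vertices of `ΔI` precede those of
`ΔJ`, so the boundary of `σ ∪ τ` obeys the Leibniz rule with the sign `(-1)^|σ|` of the tensor
product (`bd_joinFace`). -/

theorem matrixMap_apply {R : Type u} [CommRing R] {B C : Type} [Fintype B] [Fintype C]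
    (A : B → C → R) (x : B →₀ R) (c : C) : matrixMap A x c = ∑ b, x b * A b c := by
  classical
  rw [matrixMap, Finsupp.linearCombination_apply, Finsupp.sum_fintype _ _ (by simp),
    Finsupp.finsetSum_apply]
  refine Finset.sum_congr rfl fun b _ => ?_
  simp [Finsupp.single_apply]

theorem matrixComplex_d {R : Type u} [CommRing R] (B : ℕ → Type) [∀ i, Fintype (B i)]
    (A : ∀ i, B (i + 1) → B i → R)
    (h : ∀ i b d, ∑ c, A (i + 1) b c * A i c d = 0) (i : ℕ) :
    (matrixComplex B A h).d (i + 1) i = ModuleCat.ofHom (matrixMap (A i)) :=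
  ChainComplex.of_d (α := ℕ) (fun i => ModuleCat.of R (B i →₀ R))
    (fun i => ModuleCat.ofHom (matrixMap (A i))) i

/-! ### Transport of exactness and minimality along isomorphisms of complexes. -/

namespace MultigradedComplex

variable {K : Type u} [Field K] {n : ℕ}

theorem d_comp_d (F : MultigradedComplex K n) (i : ℕ) : F.d i ∘ₗ F.d (i + 1) = 0 :=
  matrixMap_comp _ _ (F.coeff_comp i)

theorem complex_d (F : MultigradedComplex K n) (i : ℕ) :
    F.complex.d (i + 1) i = ModuleCat.ofHom (F.d i) :=
  matrixComplex_d _ _ F.coeff_comp i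

/-- The linear isomorphisms that make up an isomorphism of multigraded complexes. -/
theorem IsIsomorphic.exists_linearEquiv {F G : MultigradedComplex K n} (h : F.IsIsomorphic G) :
    ∃ e : ∀ i, F.FreeModule i ≃ₗ[MvPolynomial (Fin n) K] G.FreeModule i,
      ∀ i x, G.d i (e (i + 1) x) = e i (F.d i x) := by
  obtain ⟨e, -, -⟩ := h
  refine ⟨fun i => ((HomologicalComplex.eval _ _ i).mapIso e).toLinearEquiv, fun i x => ?_⟩
  have h := e.hom.comm (i + 1) i
  rw [complex_d, complex_d] at h
  exact congrArg (fun f => f.hom x) h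

theorem IsIsomorphic.exact {F G : MultigradedComplex K n} (h : F.IsIsomorphic G) (i : ℕ)
    (hF : Function.Exact (F.d (i + 1)) (F.d i)) : Function.Exact (G.d (i + 1)) (G.d i) := by
  obtain ⟨e, he⟩ := h.exists_linearEquiv
  intro y
  obtain ⟨x, rfl⟩ := (e (i + 1)).surjective y
  rw [he, LinearEquiv.map_eq_zero_iff, hF x]
  constructor
  · rintro ⟨z, rfl⟩
    exact ⟨e _ z, he _ _⟩
  · rintro ⟨z, hz⟩
    obtain ⟨w, rfl⟩ := (e (i + 1 + 1)).surjective z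
    rw [he] at hz
    exact ⟨w, (e (i + 1)).injective hz⟩

theorem IsIsomorphic.range_d_le {F G : MultigradedComplex K n} (h : F.IsIsomorphic G) (i : ℕ)
    (a : Ideal (MvPolynomial (Fin n) K))
    (hF : LinearMap.range (F.d i) ≤ a • (⊤ : Submodule _ (F.FreeModule i))) :
    LinearMap.range (G.d i) ≤ a • (⊤ : Submodule _ (G.FreeModule i)) := by
  obtain ⟨e, he⟩ := h.exists_linearEquiv
  rintro _ ⟨y, rfl⟩
  obtain ⟨x, rfl⟩ := (e (i + 1)).surjective y
  rw [he]
  have h1 : e i (F.d i x) ∈ (a • (⊤ : Submodule _ (F.FreeModule i))).map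
      (e i : F.FreeModule i →ₗ[MvPolynomial (Fin n) K] G.FreeModule i) :=
    Submodule.mem_map_of_mem (hF ⟨x, rfl⟩)
  rw [Submodule.map_smul''] at h1
  exact Submodule.smul_mono le_rfl le_top h1

end MultigradedComplex

/-! ### Multigraded strands, minimality and augmentation of a homogenization. -/

namespace Frame

variable {K : Type u} [Field K] {n r : ℕ} (U : Frame K r) (m : Fin r → (Fin n →₀ ℕ))

/-- The differential of the homogenization. -/
def homD (i : ℕ) : (U.basis (i + 1) →₀ MvPolynomial (Fin n) K) →ₗ[MvPolynomial (Fin n) K]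
    (U.basis i →₀ MvPolynomial (Fin n) K) :=
  matrixMap fun v u => monomial (U.mdeg m (i + 1) v - U.mdeg m i u) (U.coeff i v u)

theorem homD_apply (i : ℕ) (x : U.basis (i + 1) →₀ MvPolynomial (Fin n) K) (w : U.basis i) :
    U.homD m i x w =
      ∑ v, x v * monomial (U.mdeg m (i + 1) v - U.mdeg m i w) (U.coeff i v w) :=
  matrixMap_apply _ _ _

theorem homD_comp_homD (i : ℕ) : U.homD m i ∘ₗ U.homD m (i + 1) = 0 :=
  (U.homogenization m).d_comp_d i

open Classical in
/-- The coefficients of the component of multidegree `a` of an element of the homogenization. -/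
def strand (i : ℕ) (x : (U.basis i →₀ MvPolynomial (Fin n) K)) (a : Fin n →₀ ℕ) (u : U.basis i) : K :=
  if U.mdeg m i u ≤ a then (x u).coeff (a - U.mdeg m i u) else 0

/-- The coefficient of `x^c` at the basis element `u` is visible in the strand of multidegree `c +
mdeg u`. -/
theorem strand_ext (i : ℕ) {x y : (U.basis i →₀ MvPolynomial (Fin n) K)}
    (h : ∀ a u, U.strand m i x a u = U.strand m i y a u) : x = y := by
  refine Finsupp.ext fun u => MvPolynomial.ext _ _ fun c => ?_
  have := h (c + U.mdeg m i u) u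
  simpa [strand] using this

/-- The factor `mdeg v / mdeg w` in the differential compensates for the change of label, so in each
multidegree the frame's own boundary remains. If the label of `w` does not divide `a`, neither does
the label of any `v` with `w` in its boundary, and both sides vanish. -/
theorem strand_d (i : ℕ) (x : (U.basis (i + 1) →₀ MvPolynomial (Fin n) K)) (a : Fin n →₀ ℕ)
    (w : U.basis i) : U.strand m i (U.homD m i x) a w =
      ∑ v, U.strand m (i + 1) x a v * U.coeff i v w := by
  classical
  by_cases hw : U.mdeg m i w ≤ a
  · rw [strand, if_pos hw, homD_apply, coeff_sum]
    refine Finset.sum_congr rfl fun v _ => ?_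
    rw [coeff_mul_monomial', strand]
    by_cases hc : U.coeff i v w = 0
    · simp [hc]
    have hle := U.mdeg_le m i v w hc
    have h1 : U.mdeg m (i + 1) v - U.mdeg m i w ≤ a - U.mdeg m i w ↔ U.mdeg m (i + 1) v ≤ a := by
      rw [tsub_le_iff_right, tsub_add_cancel_of_le hw]
    simp only [h1]
    split_ifs with h
    · congr 2
      ext t
      have := hle t
      have := h t
      simp only [Finsupp.tsub_apply]
      omega
    · simp
  · rw [strand, if_neg hw]
    refine (Finset.sum_eq_zero fun v _ => ?_).symm
    by_cases hc : U.coeff i v w = 0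
    · simp [hc]
    · rw [strand, if_neg (fun h => hw ((U.mdeg_le m i v w hc).trans h)), zero_mul]

/-- The element of multidegree `a` of the homogenization with given coefficients. -/
def ofStrand (i : ℕ) (a : Fin n →₀ ℕ) (z : U.basis i → K) : (U.basis i →₀ MvPolynomial (Fin n) K) :=
  Finsupp.equivFunOnFinite.symm fun u => monomial (a - U.mdeg m i u) (z u)

theorem strand_ofStrand (i : ℕ) (a b : Fin n →₀ ℕ) (z : U.basis i → K)
    (hz : ∀ u, z u ≠ 0 → U.mdeg m i u ≤ a) (u : U.basis i) :
    U.strand m i (U.ofStrand m i a z) b u = if a = b then z u else 0 := by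
  classical
  have h0 : U.ofStrand m i a z u = monomial (a - U.mdeg m i u) (z u) := rfl
  rw [strand, h0, coeff_monomial]
  by_cases hzu : z u = 0
  · simp [hzu]
  have ha := hz u hzu
  by_cases hab : a = b
  · subst hab
    simp [ha]
  · rw [if_neg hab]
    split_ifs with h1 h2
    · exact absurd (by rw [← tsub_add_cancel_of_le ha, h2, tsub_add_cancel_of_le h1]) hab
    · rfl
    · rfl

/-- Exactness in homological degree `i + 1` and multidegree `a` of the homogenization. -/
def StrandExact (i : ℕ) (a : Fin n →₀ ℕ) : Prop :=
  ∀ z : U.basis (i + 1) → K, (∀ u, z u ≠ 0 → U.mdeg m (i + 1) u ≤ a) →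
    (∀ w, ∑ u, z u * U.coeff i u w = 0) →
    ∃ y : U.basis (i + 1 + 1) → K, (∀ v, y v ≠ 0 → U.mdeg m (i + 1 + 1) v ≤ a) ∧
      ∀ u, ∑ v, y v * U.coeff (i + 1) v u = z u

variable {U m}

/-- A strand cycle becomes a homogeneous cycle of the homogenization; the strand in multidegree `a`
of any preimage is the required chain, even if that preimage is not homogeneous. -/
theorem StrandExact.of_exact {i : ℕ}
    (h : Function.Exact (U.homD m (i + 1)) (U.homD m i))
    (a : Fin n →₀ ℕ) : U.StrandExact m i a := by
  classical
  intro z hz hz0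
  obtain ⟨W, hW⟩ := (h (U.ofStrand m (i + 1) a z)).mp (U.strand_ext m i fun b w => by
    rw [strand_d]
    simp only [strand_ofStrand U m _ a b z hz]
    split_ifs
    · rw [hz0]
      simp [strand]
    · simp [strand])
  refine ⟨U.strand m _ W a, fun v hv => ?_, fun u => ?_⟩
  · by_contra hle
    exact hv (if_neg hle)
  · rw [← strand_d, hW, strand_ofStrand U m _ a a z hz, if_pos rfl]

theorem exact_of_strandExact {i : ℕ} (h : ∀ a, U.StrandExact m i a) :
    Function.Exact (U.homD m (i + 1)) (U.homD m i) := by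
  classical
  intro Z
  constructor
  swap
  · rintro ⟨W, rfl⟩
    exact LinearMap.congr_fun (U.homD_comp_homD m i) W
  intro hZ
  have h1 : ∀ a, ∃ y : U.basis (i + 1 + 1) → K,
      (∀ v, y v ≠ 0 → U.mdeg m (i + 1 + 1) v ≤ a) ∧
      ∀ u, ∑ v, y v * U.coeff (i + 1) v u = U.strand m (i + 1) Z a u := by
    intro a
    refine h a _ (fun u hu => ?_) (fun w => ?_)
    · by_contra hle
      exact hu (if_neg hle)
    · rw [← strand_d, hZ]
      simp [strand]
  choose y hy hyZ using h1
  -- The finitely many multidegrees that occur in `Z`; the chosen strand preimages are summed over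
  -- these only.
  let A : Finset (Fin n →₀ ℕ) := (Finset.univ : Finset (U.basis (i + 1))).biUnion fun u =>
    (Z u).support.image fun c => c + U.mdeg m (i + 1) u
  have hA : ∀ a u, a ∉ A → U.strand m (i + 1) Z a u = 0 := by
    intro a u ha
    rw [strand]
    split_ifs with hle
    · by_contra hne
      refine ha (Finset.mem_biUnion.mpr ⟨u, Finset.mem_univ _, Finset.mem_image.mpr
        ⟨_, mem_support_iff.mpr hne, tsub_add_cancel_of_le hle⟩⟩)
    · rfl
  refine ⟨∑ a ∈ A, U.ofStrand m _ a (y a), U.strand_ext m _ fun b u => ?_⟩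
  rw [strand_d]
  have h2 : ∀ v, U.strand m (i + 1 + 1) (∑ a ∈ A, U.ofStrand m _ a (y a)) b v =
      if b ∈ A then y b v else 0 := by
    intro v
    have h3 : U.strand m (i + 1 + 1) (∑ a ∈ A, U.ofStrand m _ a (y a)) b v =
        ∑ a ∈ A, U.strand m (i + 1 + 1) (U.ofStrand m _ a (y a)) b v := by
      simp only [strand]
      rw [Finsupp.finsetSum_apply, coeff_sum]
      split_ifs <;> simp
    rw [h3, Finset.sum_congr rfl fun a _ => strand_ofStrand U m _ a b (y a) (hy a) v]
    simp
  simp only [h2]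
  by_cases hb : b ∈ A
  · simp only [if_pos hb]
    exact hyZ b u
  · simp [hb, hA b u hb]

/-- The matrix entry at `(v, u)` is a scalar times the monomial `mdeg v / mdeg u`. It lies outside
the ideal of the variables exactly when the scalar is nonzero and the two labels coincide. -/
theorem range_d_le_iff (i : ℕ) :
    LinearMap.range (U.homD m i) ≤
      Ideal.span (Set.range (X : Fin n → MvPolynomial (Fin n) K)) •
        (⊤ : Submodule _ ((U.basis i →₀ MvPolynomial (Fin n) K))) ↔
    ∀ v u, U.coeff i v u ≠ 0 → U.mdeg m i u ≠ U.mdeg m (i + 1) v := by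
  classical
  have hmem : ∀ (a : Fin n →₀ ℕ) (c : K), c ≠ 0 →
      (monomial a c ∈ Ideal.span (Set.range (X : Fin n → MvPolynomial (Fin n) K)) ↔ a ≠ 0) := by
    intro a c hc
    rw [← Set.image_univ, mem_ideal_span_X_image, support_monomial, if_neg hc]
    simp only [Finset.mem_singleton, forall_eq, Set.mem_univ, true_and]
    simp [DFunLike.ext_iff]
  constructor
  · intro h v u hc heq
    have h1 := h ⟨Finsupp.single v 1, rfl⟩
    have h2 := Submodule.mem_map_of_mem (f := Finsupp.lapply (R := MvPolynomial (Fin n) K)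
      (M := MvPolynomial (Fin n) K) u) h1
    rw [Submodule.map_smul''] at h2
    have h3 := Submodule.smul_mono
      (le_refl (Ideal.span (Set.range (X : Fin n → MvPolynomial (Fin n) K)))) le_top h2
    rw [Ideal.smul_top_eq_map, Finsupp.lapply_apply] at h3
    have h4 : U.homD m i (Finsupp.single v 1) u = monomial 0 (U.coeff i v u) := by
      rw [homD_apply, Finset.sum_eq_single v]
      · simp [heq]
      · intro b _ hb
        rw [Finsupp.single_eq_of_ne hb, zero_mul]
      · simp
    rw [h4] at h3
    exact (hmem 0 _ hc).mp (by simpa using h3) rfl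
  · rintro h _ ⟨x, rfl⟩
    have h1 : U.homD m i x = ∑ u, ∑ v,
        (monomial (U.mdeg m (i + 1) v - U.mdeg m i u) (U.coeff i v u) :
          MvPolynomial (Fin n) K) • Finsupp.single u (x v) := by
      refine Finsupp.ext fun w => ?_
      rw [homD_apply, Finsupp.finsetSum_apply, Finset.sum_eq_single w]
      · rw [Finsupp.finsetSum_apply]
        refine Finset.sum_congr rfl fun v _ => ?_
        rw [Finsupp.smul_apply, Finsupp.single_eq_same, smul_eq_mul, mul_comm]
      · intro b _ hb
        rw [Finsupp.finsetSum_apply]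
        refine Finset.sum_eq_zero fun v _ => ?_
        rw [Finsupp.smul_apply, Finsupp.single_eq_of_ne hb.symm, smul_zero]
      · simp
    rw [h1]
    refine Submodule.sum_mem _ fun u _ => Submodule.sum_mem _ fun v _ => ?_
    by_cases hc : U.coeff i v u = 0
    · rw [hc, map_zero, zero_smul]
      exact Submodule.zero_mem _
    refine Submodule.smul_mem_smul ((hmem _ _ hc).mpr fun h0 => h v u hc ?_) trivial
    exact le_antisymm (U.mdeg_le m i v u hc) (tsub_eq_zero_iff_le.mp h0)

theorem exists_augmentation {I : Ideal (MvPolynomial (Fin n) K)}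
    (hI : monomialSpan K (Set.range m) = I) :
    ∃ ε : (U.basis 0 →₀ MvPolynomial (Fin n) K) →ₗ[MvPolynomial (Fin n) K] (MvPolynomial (Fin n) K ⧸ I),
      Function.Surjective ε ∧ Function.Exact (U.homD m 0) ε ∧
      ∀ a x, (U.homogenization m).IsHomogeneous 0 a x →
        ∃ c : K, ε x = Ideal.Quotient.mk I (monomial a c) := by
  classical
  let o : U.basis 0 := U.basisZero.symm ()
  have ho : ∀ u, u = o := fun u => by
    rw [← U.basisZero.symm_apply_apply u]
  refine ⟨(Ideal.Quotient.mkₐ (MvPolynomial (Fin n) K) I).toLinearMap ∘ₗ Finsupp.lapply o,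
    ?_, ?_, ?_⟩
  · intro y
    obtain ⟨p, rfl⟩ := Ideal.Quotient.mk_surjective y
    exact ⟨Finsupp.single o p, by simp⟩
  · intro x
    -- The single row of the first differential consists of the generators `m j`, so its image is
    -- the ideal they span.
    have h1 : ∀ z : (U.basis 1 →₀ MvPolynomial (Fin n) K), U.homD m 0 z o =
        ∑ v, z v * monomial (m (U.basisOne v)) 1 := by
      intro z
      rw [homD_apply]
      refine Finset.sum_congr rfl fun v _ => ?_
      rw [U.coeff_zero]
      simp [mdeg]
    have h2 : ((Ideal.Quotient.mkₐ (MvPolynomial (Fin n) K) I).toLinearMap ∘ₗ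
        Finsupp.lapply o) x = 0 ↔ x o ∈ I := by
      simp [Ideal.Quotient.eq_zero_iff_mem]
    rw [h2]
    constructor
    · intro hx
      rw [← hI, monomialSpan, ← Set.range_comp] at hx
      obtain ⟨c, hc⟩ := (Ideal.mem_span_range_iff_exists_fun).mp hx
      refine ⟨Finsupp.equivFunOnFinite.symm fun v => c (U.basisOne v), Finsupp.ext fun u => ?_⟩
      rw [ho u, h1, ← hc]
      exact U.basisOne.sum_comp (fun j => c j * monomial (m j) 1)
    · rintro ⟨z, rfl⟩
      rw [h1, ← hI]
      exact Ideal.sum_mem _ fun v _ => Ideal.mul_mem_left _ _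
        (Ideal.subset_span ⟨_, ⟨_, rfl⟩, rfl⟩)
  · intro a x hx
    refine ⟨(x o).coeff a, ?_⟩
    have h3 : x o = monomial a ((x o).coeff a) := by
      ext c
      rw [coeff_monomial]
      split_ifs with hac
      · rw [hac]
      · by_contra hne
        have := hx o c (mem_support_iff.mpr hne)
        exact hac (by rw [← this]; exact add_zero c)
    rw [← h3]
    rfl

end Frame

/-! ### The boundary operator on functions on finite sets of vertices -/

section Boundary

variable {K : Type u} [Field K] {r : ℕ}

theorem exists_of_boundaryCoeff_ne_zero {σ τ : Finset (Fin r)} (h : boundaryCoeff K σ τ ≠ 0) :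
    ∃ j ∈ σ, τ = σ.erase j := by
  by_contra! hne
  exact h (Finset.sum_eq_zero fun j hj => if_neg (hne j hj))

theorem subset_of_boundaryCoeff_ne_zero {σ τ : Finset (Fin r)} (h : boundaryCoeff K σ τ ≠ 0) :
    τ ⊆ σ := by
  obtain ⟨j, -, rfl⟩ := exists_of_boundaryCoeff_ne_zero h
  exact Finset.erase_subset _ _

theorem card_of_boundaryCoeff_ne_zero {σ τ : Finset (Fin r)} (h : boundaryCoeff K σ τ ≠ 0) :
    σ.card = τ.card + 1 := by
  obtain ⟨j, hj, rfl⟩ := exists_of_boundaryCoeff_ne_zero h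
  exact (Finset.card_erase_add_one hj).symm

theorem boundaryCoeff_erase {σ : Finset (Fin r)} {j : Fin r} (hj : j ∈ σ) :
    boundaryCoeff K σ (σ.erase j) = sign K j σ := by
  rw [boundaryCoeff, Finset.sum_eq_single j, if_pos rfl]
  · intro k hk hkj
    rw [if_neg]
    intro h
    have : k ∈ σ.erase j := Finset.mem_erase.mpr ⟨hkj, hk⟩
    rw [h] at this
    exact Finset.notMem_erase _ _ this
  · exact fun h => absurd hj h

theorem boundaryCoeff_erase_ne_zero {σ : Finset (Fin r)} {j : Fin r} (hj : j ∈ σ) :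
    boundaryCoeff K σ (σ.erase j) ≠ 0 := by
  rw [boundaryCoeff_erase hj]
  exact pow_ne_zero _ (neg_ne_zero.mpr one_ne_zero)

/-- Extending sums by zero to all finite sets of vertices lets chains be handled as functions on
`Finset (Fin r)`, free of the dependent index of face and cardinality. -/
theorem sum_facesOfCard {M : Type*} [AddCommMonoid M] (Δ : AbstractSimplicialComplex (Fin r))
    (i : ℕ) (f : Finset (Fin r) → M) (hf : ∀ σ, ¬(σ ∈ allFaces Δ ∧ σ.card = i) → f σ = 0) :
    ∑ v : FacesOfCard Δ i, f v.1 = ∑ σ, f σ := by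
  classical
  rw [← Finset.sum_filter_of_ne (p := fun σ => σ ∈ allFaces Δ ∧ σ.card = i)
    (fun σ _ h => by_contra fun h' => h (hf σ h'))]
  exact (Finset.sum_subtype _ (by simp) f).symm

/-- The boundary operator on all functions on the finite sets of vertices. -/
def bd (K : Type u) [Field K] (r : ℕ) : (Finset (Fin r) → K) →ₗ[K] (Finset (Fin r) → K) :=
  Matrix.vecMulLinear (Matrix.of fun σ τ => boundaryCoeff K σ τ)

theorem bd_apply (c : Finset (Fin r) → K) (τ : Finset (Fin r)) :
    bd K r c τ = ∑ σ, c σ * boundaryCoeff K σ τ := rfl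

/-- The full simplex. -/
def simplex (r : ℕ) : AbstractSimplicialComplex (Fin r) where
  faces := {σ | σ.Nonempty}
  isRelLowerSet_faces := fun _ hσ => ⟨hσ, fun _ _ h => h⟩
  singleton_mem := Finset.singleton_nonempty

theorem mem_allFaces_simplex (σ : Finset (Fin r)) : σ ∈ allFaces (simplex r) :=
  σ.eq_empty_or_nonempty

theorem bd_bd (c : Finset (Fin r) → K) : bd K r (bd K r c) = 0 := by
  funext τ
  simp only [bd_apply, Finset.sum_mul, Pi.zero_apply]
  rw [Finset.sum_comm]
  refine Finset.sum_eq_zero fun σ _ => ?_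
  simp only [mul_assoc]
  rw [← Finset.mul_sum]
  -- Unless `|σ| = |τ| + 2`, no intermediate `ρ` has both coefficients nonzero.
  by_cases hc : σ.card = τ.card + 1 + 1
  · have h := boundaryCoeff_comp K (simplex r) (i := τ.card)
      ⟨σ, mem_allFaces_simplex σ, hc⟩ ⟨τ, mem_allFaces_simplex τ, rfl⟩
    rw [sum_facesOfCard (simplex r) (τ.card + 1)
      (fun ρ => boundaryCoeff K σ ρ * boundaryCoeff K ρ τ)] at h
    · rw [h, mul_zero]
    · intro ρ hρ
      by_contra hne
      exact hρ ⟨mem_allFaces_simplex ρ, card_of_boundaryCoeff_ne_zero (right_ne_zero_of_mul hne)⟩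
  · rw [Finset.sum_eq_zero, mul_zero]
    intro ρ _
    by_contra hne
    have h1 := card_of_boundaryCoeff_ne_zero (left_ne_zero_of_mul hne)
    have h2 := card_of_boundaryCoeff_ne_zero (right_ne_zero_of_mul hne)
    omega

/-- The functions supported on `S`. -/
def chains (K : Type u) [Field K] {X : Type} (S : Set X) : Submodule K (X → K) where
  carrier := {c | ∀ σ ∉ S, c σ = 0}
  add_mem' := fun {a b} ha hb σ hσ => by simp [ha σ hσ, hb σ hσ]
  zero_mem' := fun _ _ => rfl
  smul_mem' := fun k a ha σ hσ => by simp [ha σ hσ]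

theorem bd_mem_chains {S : Set (Finset (Fin r))} (hS : IsLowerSet S) {c : Finset (Fin r) → K}
    (hc : c ∈ chains K S) : bd K r c ∈ chains K S := by
  intro τ hτ
  rw [bd_apply]
  refine Finset.sum_eq_zero fun σ _ => ?_
  by_contra hne
  refine left_ne_zero_of_mul hne (hc σ fun hσ => hτ ?_)
  exact hS (subset_of_boundaryCoeff_ne_zero (right_ne_zero_of_mul hne)) hσ

/-- Acyclicity of the augmented chain complex of a family of finite sets of vertices. -/
def Acyclic (K : Type u) [Field K] (S : Set (Finset (Fin r))) : Prop :=
  ∀ c ∈ chains K S, bd K r c = 0 → ∃ w ∈ chains K S, bd K r w = c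

open Classical in
/-- The part of a chain on the faces with `k` elements. -/
def part (k : ℕ) (c : Finset (Fin r) → K) : Finset (Fin r) → K :=
  fun σ => if σ.card = k then c σ else 0

/-- The boundary lowers cardinality by one, so the pieces of a cycle in each cardinality are again
cycles. This links `Acyclic`, which is ungraded, with exactness in each homological degree. -/
theorem bd_part (k : ℕ) (c : Finset (Fin r) → K) (τ : Finset (Fin r)) :
    bd K r (part k c) τ = if τ.card + 1 = k then bd K r c τ else 0 := by
  have h : ∀ σ, part k c σ * boundaryCoeff K σ τ =
      if τ.card + 1 = k then c σ * boundaryCoeff K σ τ else 0 := by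
    intro σ
    by_cases hc : boundaryCoeff K σ τ = 0
    · simp [hc]
    · rw [part, card_of_boundaryCoeff_ne_zero hc]
      split_ifs <;> simp
  rw [bd_apply, Finset.sum_congr rfl fun σ _ => h σ]
  split_ifs
  · rfl
  · exact Finset.sum_const_zero

theorem sum_part (c : Finset (Fin r) → K) : ∑ k ∈ Finset.range (r + 1), part k c = c := by
  funext σ
  rw [Finset.sum_apply]
  simp only [part, Finset.sum_ite_eq, Finset.mem_range]
  rw [if_pos (Nat.lt_succ_of_le (by simpa using σ.card_le_univ))]

end Boundary

/-! ### Joins -/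

section Join

variable {r s : ℕ}

/-- The union of faces of two complexes, as a face of the join. -/
def joinFace (σ : Finset (Fin r)) (τ : Finset (Fin s)) : Finset (Fin (r + s)) :=
  σ.map (Fin.castAddEmb s) ∪ τ.map (Fin.natAddEmb r)

theorem castAdd_mem_joinFace {σ : Finset (Fin r)} {τ : Finset (Fin s)} {j : Fin r} :
    Fin.castAdd s j ∈ joinFace σ τ ↔ j ∈ σ := by
  simp only [joinFace, Finset.mem_union, Finset.mem_map, Fin.castAddEmb_apply,
    Fin.natAddEmb_apply, Fin.castAdd_inj, exists_eq_right, or_iff_left_iff_imp]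
  rintro ⟨k, -, hk⟩
  have := congrArg Fin.val hk
  simp at this
  omega

theorem natAdd_mem_joinFace {σ : Finset (Fin r)} {τ : Finset (Fin s)} {k : Fin s} :
    Fin.natAdd r k ∈ joinFace σ τ ↔ k ∈ τ := by
  simp only [joinFace, Finset.mem_union, Finset.mem_map, Fin.castAddEmb_apply,
    Fin.natAddEmb_apply, Fin.natAdd_inj, exists_eq_right, or_iff_right_iff_imp]
  rintro ⟨j, -, hj⟩
  have := congrArg Fin.val hj
  simp at this
  omega

theorem finset_ext_castAdd_natAdd {ρ ρ' : Finset (Fin (r + s))}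
    (h1 : ∀ j, Fin.castAdd s j ∈ ρ ↔ Fin.castAdd s j ∈ ρ')
    (h2 : ∀ k, Fin.natAdd r k ∈ ρ ↔ Fin.natAdd r k ∈ ρ') : ρ = ρ' := by
  ext x
  induction x using Fin.addCases with
  | left j => exact h1 j
  | right k => exact h2 k

/-- Faces of a join are pairs of faces. -/
def joinEquiv (r s : ℕ) : Finset (Fin r) × Finset (Fin s) ≃ Finset (Fin (r + s)) where
  toFun p := joinFace p.1 p.2
  invFun ρ := (Finset.univ.filter fun j => Fin.castAdd s j ∈ ρ,
    Finset.univ.filter fun k => Fin.natAdd r k ∈ ρ)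
  left_inv p := by
    ext <;> simp [castAdd_mem_joinFace, natAdd_mem_joinFace]
  right_inv ρ := finset_ext_castAdd_natAdd (by simp [castAdd_mem_joinFace])
    (by simp [natAdd_mem_joinFace])

theorem joinFace_inj {σ σ' : Finset (Fin r)} {τ τ' : Finset (Fin s)} :
    joinFace σ τ = joinFace σ' τ' ↔ σ = σ' ∧ τ = τ' := by
  rw [← Prod.mk.injEq]
  exact (joinEquiv r s).apply_eq_iff_eq (x := (σ, τ)) (y := (σ', τ'))

theorem disjoint_joinFace (σ : Finset (Fin r)) (τ : Finset (Fin s)) :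
    Disjoint (σ.map (Fin.castAddEmb s)) (τ.map (Fin.natAddEmb r)) := by
  rw [Finset.disjoint_left]
  rintro x hx hx'
  obtain ⟨j, -, rfl⟩ := Finset.mem_map.mp hx
  obtain ⟨k, -, hk⟩ := Finset.mem_map.mp hx'
  have := congrArg Fin.val hk
  simp at this
  omega

theorem card_joinFace (σ : Finset (Fin r)) (τ : Finset (Fin s)) :
    (joinFace σ τ).card = σ.card + τ.card := by
  rw [joinFace, Finset.card_union_of_disjoint (disjoint_joinFace σ τ), Finset.card_map,
    Finset.card_map]

theorem joinFace_subset_iff {σ σ' : Finset (Fin r)} {τ τ' : Finset (Fin s)} :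
    joinFace σ τ ⊆ joinFace σ' τ' ↔ σ ⊆ σ' ∧ τ ⊆ τ' := by
  constructor
  · intro h
    exact ⟨fun j hj => castAdd_mem_joinFace.mp (h (castAdd_mem_joinFace.mpr hj)),
      fun k hk => natAdd_mem_joinFace.mp (h (natAdd_mem_joinFace.mpr hk))⟩
  · rintro ⟨h1, h2⟩
    exact Finset.union_subset_union (Finset.map_subset_map.mpr h1) (Finset.map_subset_map.mpr h2)

theorem joinFace_erase_castAdd (σ : Finset (Fin r)) (τ : Finset (Fin s)) (j : Fin r) :
    (joinFace σ τ).erase (Fin.castAdd s j) = joinFace (σ.erase j) τ := by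
  refine finset_ext_castAdd_natAdd (fun i => ?_) (fun k => ?_)
  · simp [castAdd_mem_joinFace]
  · have : Fin.natAdd r k ≠ Fin.castAdd s j := by
      intro h
      have := congrArg Fin.val h
      simp at this
      omega
    simp [natAdd_mem_joinFace, this]

theorem joinFace_erase_natAdd (σ : Finset (Fin r)) (τ : Finset (Fin s)) (k : Fin s) :
    (joinFace σ τ).erase (Fin.natAdd r k) = joinFace σ (τ.erase k) := by
  refine finset_ext_castAdd_natAdd (fun j => ?_) (fun i => ?_)
  · have : Fin.castAdd s j ≠ Fin.natAdd r k := by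
      intro h
      have := congrArg Fin.val h
      simp at this
      omega
    simp [castAdd_mem_joinFace, this]
  · simp [natAdd_mem_joinFace]

theorem sum_joinFace {M : Type*} [AddCommMonoid M] (σ : Finset (Fin r)) (τ : Finset (Fin s))
    (f : Fin (r + s) → M) : ∑ x ∈ joinFace σ τ, f x =
      ∑ j ∈ σ, f (Fin.castAdd s j) + ∑ k ∈ τ, f (Fin.natAdd r k) := by
  rw [joinFace, Finset.sum_union (disjoint_joinFace σ τ), Finset.sum_map, Finset.sum_map]
  rfl

theorem sup_joinFace {α : Type*} [SemilatticeSup α] [OrderBot α] (σ : Finset (Fin r))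
    (τ : Finset (Fin s)) (f : Fin r → α) (g : Fin s → α) :
    (joinFace σ τ).sup (Fin.append f g) = σ.sup f ⊔ τ.sup g := by
  rw [joinFace, Finset.sup_union, Finset.sup_map, Finset.sup_map]
  congr 1
  · exact Finset.sup_congr rfl fun j _ => Fin.append_left f g j
  · exact Finset.sup_congr rfl fun k _ => Fin.append_right f g k

theorem joinFace_mem_allFaces_join {ΔI : AbstractSimplicialComplex (Fin r)}
    {ΔJ : AbstractSimplicialComplex (Fin s)} {σ : Finset (Fin r)} {τ : Finset (Fin s)} :
    joinFace σ τ ∈ allFaces (join ΔI ΔJ) ↔ σ ∈ allFaces ΔI ∧ τ ∈ allFaces ΔJ := by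
  constructor
  · rintro (h | ⟨-, σ', hσ', τ', hτ', h⟩)
    · have h0 : joinFace σ τ = joinFace ∅ ∅ := by simpa [joinFace] using h
      obtain ⟨rfl, rfl⟩ := joinFace_inj.mp h0
      exact ⟨Or.inl rfl, Or.inl rfl⟩
    · obtain ⟨rfl, rfl⟩ := joinFace_inj.mp h
      exact ⟨hσ', hτ'⟩
  · rintro ⟨hσ, hτ⟩
    rcases (joinFace σ τ).eq_empty_or_nonempty with h | h
    · exact Or.inl h
    · exact Or.inr ⟨h, σ, hσ, τ, hτ, rfl⟩

variable {K : Type u} [Field K]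

theorem sign_castAdd (σ : Finset (Fin r)) (τ : Finset (Fin s)) (j : Fin r) :
    sign K (Fin.castAdd s j) (joinFace σ τ) = sign K j σ := by
  have h : (joinFace σ τ).filter (fun x => x < Fin.castAdd s j) =
      joinFace (σ.filter fun x => x < j) ∅ := by
    refine finset_ext_castAdd_natAdd (fun i => ?_) (fun k => ?_)
    · have : Fin.castAdd s i < Fin.castAdd s j ↔ i < j := Iff.rfl
      simp [castAdd_mem_joinFace, this]
    · have : ¬ Fin.natAdd r k < Fin.castAdd s j := by
        rw [Fin.lt_def]
        simp
        omega
      simp [natAdd_mem_joinFace, this]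
  rw [sign, sign, h, card_joinFace, Finset.card_empty, add_zero]

/-- All `|σ|` vertices of the first factor precede `k`. -/
theorem sign_natAdd (σ : Finset (Fin r)) (τ : Finset (Fin s)) (k : Fin s) :
    sign K (Fin.natAdd r k) (joinFace σ τ) = (-1) ^ σ.card * sign K k τ := by
  have h : (joinFace σ τ).filter (fun x => x < Fin.natAdd r k) =
      joinFace σ (τ.filter fun x => x < k) := by
    refine finset_ext_castAdd_natAdd (fun j => ?_) (fun i => ?_)
    · have : Fin.castAdd s j < Fin.natAdd r k := by
        rw [Fin.lt_def]
        simp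
        omega
      simp [castAdd_mem_joinFace, this]
    · simp [natAdd_mem_joinFace]
  rw [sign, sign, h, card_joinFace, pow_add]

theorem boundaryCoeff_joinFace (σ σ' : Finset (Fin r)) (τ τ' : Finset (Fin s)) :
    boundaryCoeff K (joinFace σ τ) (joinFace σ' τ') =
      (if τ = τ' then boundaryCoeff K σ σ' else 0) +
        if σ = σ' then (-1) ^ σ.card * boundaryCoeff K τ τ' else 0 := by
  rw [boundaryCoeff, sum_joinFace]
  simp only [joinFace_erase_castAdd, joinFace_erase_natAdd, sign_castAdd, sign_natAdd,
    joinFace_inj]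
  congr 1
  · split_ifs with h
    · exact Finset.sum_congr rfl fun j _ => by simp [h]
    · exact Finset.sum_eq_zero fun j _ => if_neg fun h' => h h'.2.symm
  · split_ifs with h
    · rw [boundaryCoeff, Finset.mul_sum]
      exact Finset.sum_congr rfl fun k _ => by simp [h]
    · exact Finset.sum_eq_zero fun j _ => if_neg fun h' => h h'.1.symm

/-- The Leibniz rule, read on coefficients: a set that covers `σ ∪ τ` gains its extra vertex in one
factor or in the other. -/
theorem bd_joinFace (c : Finset (Fin (r + s)) → K) (σ : Finset (Fin r)) (τ : Finset (Fin s)) :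
    bd K (r + s) c (joinFace σ τ) = bd K r (fun σ' => c (joinFace σ' τ)) σ +
      (-1) ^ σ.card * bd K s (fun τ' => c (joinFace σ τ')) τ := by
  rw [bd_apply, ← (joinEquiv r s).sum_comp, Fintype.sum_prod_type]
  simp only [joinEquiv, Equiv.coe_fn_mk, boundaryCoeff_joinFace, mul_add, Finset.sum_add_distrib,
    mul_ite, mul_zero, Finset.sum_ite_eq', Finset.mem_univ, if_true]
  congr 1
  rw [Finset.sum_comm]
  simp only [Finset.sum_ite_eq', Finset.mem_univ, if_true]
  rw [bd_apply, Finset.mul_sum]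
  exact Finset.sum_congr rfl fun τ' _ => by ring

/-- A complex `Y → M` whose differential is, up to terms from elements of `Y` of higher degree,
exact on each `M`, is exact. -/
theorem exact_of_exact_graded {Y M : Type*} [AddCommGroup M] [Module K M] (deg : Y → ℕ) (b : ℕ)
    (hdeg : ∀ y, deg y < b) (D : (Y → M) →ₗ[K] (Y → M)) (δ : Y → M →ₗ[K] M)
    (N : Y → Submodule K M) (hDD : ∀ c, D (D c) = 0)
    (hδ : ∀ c y, (∀ y', deg y < deg y' → c y' = 0) → D c y = δ y (c y))
    (hN : ∀ c, (∀ y, c y ∈ N y) → ∀ y, D c y ∈ N y)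
    (hex : ∀ y, ∀ z ∈ N y, δ y z = 0 → ∃ w ∈ N y, δ y w = z)
    (c : Y → M) (hc : ∀ y, c y ∈ N y) (hDc : D c = 0) : ∃ w, (∀ y, w y ∈ N y) ∧ D w = c := by
  classical
  have key : ∀ t (c : Y → M), (∀ y, t ≤ deg y → c y = 0) → (∀ y, c y ∈ N y) → D c = 0 →
      ∃ w, (∀ y, w y ∈ N y) ∧ D w = c := by
    intro t
    induction t with
    | zero =>
      intro c h _ _
      exact ⟨0, fun y => (N y).zero_mem, by rw [map_zero]; exact funext fun y => (h y zero_le).symm⟩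
    | succ t ih =>
      intro c h hc hDc
      -- Above degree `t` the cycle `c` vanishes, so in degree `t` the equation `D c = 0` reads `δ y
      -- (c y) = 0` and `c y` can be lifted.
      have h1 : ∀ y, ∃ w ∈ N y, (deg y ≠ t → w = 0) ∧ (deg y = t → δ y w = c y) := by
        intro y
        by_cases hy : deg y = t
        · obtain ⟨w, hw, hwc⟩ := hex y (c y) (hc y) (by
            rw [← hδ c y fun y' hy' => h y' (by omega), hDc]
            rfl)
          exact ⟨w, hw, fun h => absurd hy h, fun _ => hwc⟩
        · exact ⟨0, (N y).zero_mem, fun _ => rfl, fun h => absurd h hy⟩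
      choose w hwN hw0 hw1 using h1
      -- Subtracting `D w` kills degree `t` and leaves the higher degrees zero, since `w` is
      -- concentrated in degree `t`.
      obtain ⟨w', hw', hDw'⟩ := ih (c - D w) (fun y hy => by
          rw [Pi.sub_apply, hδ w y fun y' hy' => hw0 y' (by omega)]
          rcases hy.eq_or_lt with heq | hlt
          · rw [hw1 y heq.symm, sub_self]
          · rw [h y hlt, hw0 y (by omega), map_zero, sub_self])
        (fun y => (N y).sub_mem (hc y) (hN w hwN y)) (by rw [map_sub, hDc, hDD, sub_zero])
      exact ⟨w' + w, fun y => (N y).add_mem (hw' y) (hwN y), by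
        rw [map_add, hDw', sub_add_cancel]⟩
  exact key b c (fun y hy => absurd (hdeg y) (by omega)) hc hDc

/-- The sets of vertices that are unions of a member of `A` and a member of `B`. -/
def joinSet (A : Set (Finset (Fin r))) (B : Set (Finset (Fin s))) : Set (Finset (Fin (r + s))) :=
  {ρ | ((joinEquiv r s).symm ρ).1 ∈ A ∧ ((joinEquiv r s).symm ρ).2 ∈ B}

theorem joinEquiv_symm_joinFace (σ : Finset (Fin r)) (τ : Finset (Fin s)) :
    (joinEquiv r s).symm (joinFace σ τ) = (σ, τ) :=
  (joinEquiv r s).symm_apply_apply (σ, τ)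

theorem joinFace_joinEquiv_symm (ρ : Finset (Fin (r + s))) :
    joinFace ((joinEquiv r s).symm ρ).1 ((joinEquiv r s).symm ρ).2 = ρ :=
  (joinEquiv r s).apply_symm_apply ρ

theorem joinFace_mem_joinSet {A : Set (Finset (Fin r))} {B : Set (Finset (Fin s))}
    {σ : Finset (Fin r)} {τ : Finset (Fin s)} :
    joinFace σ τ ∈ joinSet A B ↔ σ ∈ A ∧ τ ∈ B := by
  rw [joinSet, Set.mem_ofPred_eq, joinEquiv_symm_joinFace]

theorem isLowerSet_joinSet {A : Set (Finset (Fin r))} {B : Set (Finset (Fin s))}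
    (hA : IsLowerSet A) (hB : IsLowerSet B) : IsLowerSet (joinSet A B) := by
  intro ρ ρ' h
  rw [← joinFace_joinEquiv_symm ρ, ← joinFace_joinEquiv_symm ρ'] at h ⊢
  rw [joinFace_mem_joinSet, joinFace_mem_joinSet]
  have h' := joinFace_subset_iff.mp h
  exact fun h2 => ⟨hA h'.1 h2.1, hB h'.2 h2.2⟩

/-- A chain on the join is a family, indexed by `τ`, of chains in the first factor. Filtered by
`|τ|`, its differential has leading term `bd K r` on each member, which is exact; the `τ`-boundary
only brings in terms from larger `τ`. -/
theorem Acyclic.join_left {A : Set (Finset (Fin r))} {B : Set (Finset (Fin s))}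
    (hA : IsLowerSet A) (hB : IsLowerSet B) (h : Acyclic K A) : Acyclic K (joinSet A B) := by
  intro c hc hbc
  let unc : (Finset (Fin s) → Finset (Fin r) → K) → Finset (Fin (r + s)) → K :=
    fun c ρ => c ((joinEquiv r s).symm ρ).2 ((joinEquiv r s).symm ρ).1
  have hunc : ∀ c σ τ, unc c (joinFace σ τ) = c τ σ := fun c σ τ => by
    simp only [unc, joinEquiv_symm_joinFace]
  have hunc' : ∀ c : Finset (Fin (r + s)) → K, unc (fun τ σ => c (joinFace σ τ)) = c := fun c =>
    funext fun ρ => congrArg c (joinFace_joinEquiv_symm ρ)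
  let D : (Finset (Fin s) → Finset (Fin r) → K) →ₗ[K] (Finset (Fin s) → Finset (Fin r) → K) :=
    { toFun := fun c τ σ => bd K (r + s) (unc c) (joinFace σ τ)
      map_add' := fun c c' => funext fun τ => funext fun σ =>
        congrFun (map_add (bd K (r + s)) (unc c) (unc c')) (joinFace σ τ)
      map_smul' := fun k c => funext fun τ => funext fun σ =>
        congrFun (map_smul (bd K (r + s)) k (unc c)) (joinFace σ τ) }
  have hD : ∀ c, unc (D c) = bd K (r + s) (unc c) := fun c => hunc' (bd K (r + s) (unc c))
  have hunc_mem : ∀ c, (∀ τ, c τ ∈ chains K {σ | σ ∈ A ∧ τ ∈ B}) ↔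
      unc c ∈ chains K (joinSet A B) := by
    intro c
    constructor
    · intro hc ρ hρ
      exact hc _ _ hρ
    · intro hc τ σ hσ
      rw [← hunc c σ τ]
      exact hc _ fun h' => hσ (joinFace_mem_joinSet.mp h')
  obtain ⟨w, hw, hwc⟩ := exact_of_exact_graded (K := K) (M := Finset (Fin r) → K)
    (Finset.card : Finset (Fin s) → ℕ) (s + 1)
    (fun y => Nat.lt_succ_of_le (by simpa using y.card_le_univ)) D (fun _ => bd K r)
    -- For `τ ∉ B` this is the zero space, where exactness is trivial.
    (fun τ => chains K {σ | σ ∈ A ∧ τ ∈ B})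
    (fun c => funext fun τ => funext fun σ => by
      change bd K (r + s) (unc (D c)) (joinFace σ τ) = 0
      rw [hD, bd_bd]
      rfl)
    (fun c τ hτ => funext fun σ => by
      change bd K (r + s) (unc c) (joinFace σ τ) = _
      rw [bd_joinFace]
      simp only [hunc]
      rw [bd_apply (r := s), Finset.sum_eq_zero, mul_zero, add_zero]
      intro τ' _
      by_contra hne
      have := card_of_boundaryCoeff_ne_zero (right_ne_zero_of_mul hne)
      exact left_ne_zero_of_mul hne (congrFun (hτ τ' (by omega)) σ))
    (fun c hc => by
      rw [hunc_mem] at hc ⊢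
      rw [hD]
      exact bd_mem_chains (isLowerSet_joinSet hA hB) hc)
    (fun τ z hz hbz => by
      by_cases hτ : τ ∈ B
      · simp only [hτ, and_true, Set.ofPred_mem_eq] at hz ⊢
        exact h z hz hbz
      · refine ⟨0, Submodule.zero_mem _, ?_⟩
        rw [map_zero]
        exact funext fun σ => (hz σ fun h' => hτ h'.2).symm)
    (fun τ σ => c (joinFace σ τ)) ((hunc_mem _).mpr (by rwa [hunc']))
    (funext fun τ => funext fun σ => by
      change bd K (r + s) (unc fun τ σ => c (joinFace σ τ)) (joinFace σ τ) = 0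
      rw [hunc', hbc]
      rfl)
  refine ⟨unc w, (hunc_mem w).mp hw, ?_⟩
  rw [← hD, hwc, hunc']

/-- The same filtration argument with the factors exchanged, now by `|σ|`. The leading term carries
the sign `(-1)^|σ|`, a unit, which does not affect exactness. -/
theorem Acyclic.join_right {A : Set (Finset (Fin r))} {B : Set (Finset (Fin s))}
    (hA : IsLowerSet A) (hB : IsLowerSet B) (h : Acyclic K B) : Acyclic K (joinSet A B) := by
  intro c hc hbc
  let unc : (Finset (Fin r) → Finset (Fin s) → K) → Finset (Fin (r + s)) → K :=
    fun c ρ => c ((joinEquiv r s).symm ρ).1 ((joinEquiv r s).symm ρ).2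
  have hunc : ∀ c σ τ, unc c (joinFace σ τ) = c σ τ := fun c σ τ => by
    simp only [unc, joinEquiv_symm_joinFace]
  have hunc' : ∀ c : Finset (Fin (r + s)) → K, unc (fun σ τ => c (joinFace σ τ)) = c := fun c =>
    funext fun ρ => congrArg c (joinFace_joinEquiv_symm ρ)
  let D : (Finset (Fin r) → Finset (Fin s) → K) →ₗ[K] (Finset (Fin r) → Finset (Fin s) → K) :=
    { toFun := fun c σ τ => bd K (r + s) (unc c) (joinFace σ τ)
      map_add' := fun c c' => funext fun σ => funext fun τ =>
        congrFun (map_add (bd K (r + s)) (unc c) (unc c')) (joinFace σ τ)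
      map_smul' := fun k c => funext fun σ => funext fun τ =>
        congrFun (map_smul (bd K (r + s)) k (unc c)) (joinFace σ τ) }
  have hD : ∀ c, unc (D c) = bd K (r + s) (unc c) := fun c => hunc' (bd K (r + s) (unc c))
  have hunc_mem : ∀ c, (∀ σ, c σ ∈ chains K {τ | σ ∈ A ∧ τ ∈ B}) ↔
      unc c ∈ chains K (joinSet A B) := by
    intro c
    constructor
    · intro hc ρ hρ
      exact hc _ _ hρ
    · intro hc σ τ hσ
      rw [← hunc c σ τ]
      exact hc _ fun h' => hσ (joinFace_mem_joinSet.mp h')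
  obtain ⟨w, hw, hwc⟩ := exact_of_exact_graded (K := K) (M := Finset (Fin s) → K)
    (Finset.card : Finset (Fin r) → ℕ) (r + 1)
    (fun y => Nat.lt_succ_of_le (by simpa using y.card_le_univ)) D
    (fun σ => (-1 : K) ^ σ.card • bd K s)
    (fun σ => chains K {τ | σ ∈ A ∧ τ ∈ B})
    (fun c => funext fun σ => funext fun τ => by
      change bd K (r + s) (unc (D c)) (joinFace σ τ) = 0
      rw [hD, bd_bd]
      rfl)
    (fun c σ hσ => funext fun τ => by
      change bd K (r + s) (unc c) (joinFace σ τ) = _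
      rw [bd_joinFace]
      simp only [hunc]
      rw [bd_apply (r := r), Finset.sum_eq_zero, zero_add]
      · rfl
      intro σ' _
      by_contra hne
      have := card_of_boundaryCoeff_ne_zero (right_ne_zero_of_mul hne)
      exact left_ne_zero_of_mul hne (congrFun (hσ σ' (by omega)) τ))
    (fun c hc => by
      rw [hunc_mem] at hc ⊢
      rw [hD]
      exact bd_mem_chains (isLowerSet_joinSet hA hB) hc)
    (fun σ z hz hbz => by
      have hu : (-1 : K) ^ σ.card ≠ 0 := pow_ne_zero _ (neg_ne_zero.mpr one_ne_zero)
      by_cases hσ : σ ∈ A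
      · simp only [hσ, true_and, Set.ofPred_mem_eq] at hz ⊢
        obtain ⟨w, hw, rfl⟩ := h z hz (by simpa [hu] using hbz)
        exact ⟨((-1 : K) ^ σ.card)⁻¹ • w, Submodule.smul_mem _ _ hw, by simp [smul_smul, hu]⟩
      · refine ⟨0, Submodule.zero_mem _, ?_⟩
        rw [map_zero]
        exact funext fun τ => (hz τ fun h' => hσ h'.1).symm)
    (fun σ τ => c (joinFace σ τ)) ((hunc_mem _).mpr (by rwa [hunc']))
    (funext fun σ => funext fun τ => by
      change bd K (r + s) (unc fun σ τ => c (joinFace σ τ)) (joinFace σ τ) = 0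
      rw [hunc', hbc]
      rfl)
  refine ⟨unc w, (hunc_mem w).mp hw, ?_⟩
  rw [← hD, hwc, hunc']

end Join

variable {K : Type u} [Field K] {n r s : ℕ}

/-! ### Strands of the homogenization of a simplicial frame -/

theorem simplicialFrame_mdeg (Δ : AbstractSimplicialComplex (Fin r)) (m : Fin r → (Fin n →₀ ℕ)) :
    ∀ (i : ℕ) (σ : FacesOfCard Δ i), (simplicialFrame K Δ).mdeg m i σ = σ.1.sup m
  | 0, σ => by
    rw [Finset.card_eq_zero.mp σ.2.2]
    rfl
  | 1, σ => by
    obtain ⟨j, hj⟩ := (simplicialFrame K Δ).basisOne.symm.surjective σ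
    have h1 : σ.1 = {j} := congrArg Subtype.val hj.symm
    rw [h1, Finset.sup_singleton, ← hj]
    exact congrArg m ((simplicialFrame K Δ).basisOne.apply_symm_apply j)
  | i + 2, σ => by
    classical
    refine le_antisymm (Finset.sup_le fun τ hτ => ?_) (Finset.sup_le fun j hj => ?_)
    · rw [simplicialFrame_mdeg Δ m (i + 1) τ]
      exact Finset.sup_mono (subset_of_boundaryCoeff_ne_zero (Finset.mem_filter.mp hτ).2)
    · have hcard : 1 < σ.1.card := by
        rw [σ.2.2]
        omega
      -- With at least two vertices, every `j ∈ σ` survives in some facet `σ \ k`, so the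
      -- inductively defined lcm sees all vertex labels.
      obtain ⟨k, hk, hkj⟩ := Finset.exists_mem_ne hcard j
      let τ : FacesOfCard Δ (i + 1) := ⟨σ.1.erase k,
        allFaces_mono Δ σ.2.1 (Finset.erase_subset _ _), by
          rw [Finset.card_erase_of_mem hk, σ.2.2]
          rfl⟩
      have h1 : (simplicialFrame K Δ).mdeg m (i + 1) τ ≤ (simplicialFrame K Δ).mdeg m (i + 2) σ :=
        (simplicialFrame K Δ).mdeg_le m (i + 1) σ τ (boundaryCoeff_erase_ne_zero hk)
      rw [simplicialFrame_mdeg Δ m (i + 1) τ] at h1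
      exact (Finset.le_sup (f := m) (Finset.mem_erase.mpr ⟨hkj.symm, hj⟩)).trans h1

theorem simplicialFrame_strandExact_iff (Δ : AbstractSimplicialComplex (Fin r))
    (m : Fin r → (Fin n →₀ ℕ)) (i : ℕ) (a : Fin n →₀ ℕ) :
    (simplicialFrame K Δ).StrandExact m i a ↔
      ∀ z : FacesOfCard Δ (i + 1) → K, (∀ u, z u ≠ 0 → u.1.sup m ≤ a) →
        (∀ w : FacesOfCard Δ i, ∑ u, z u * boundaryCoeff K u.1 w.1 = 0) →
        ∃ y : FacesOfCard Δ (i + 1 + 1) → K, (∀ v, y v ≠ 0 → v.1.sup m ≤ a) ∧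
          ∀ u : FacesOfCard Δ (i + 1), ∑ v, y v * boundaryCoeff K v.1 u.1 = z u := by
  have h : ∀ i, (simplicialFrame K Δ).mdeg m i = fun σ : FacesOfCard Δ i => σ.1.sup m :=
    fun i => funext fun σ => simplicialFrame_mdeg Δ m i σ
  unfold Frame.StrandExact
  rw [h, h]
  exact Iff.rfl

/-- The faces whose label divides the monomial `a`. -/
def facesBelow (Δ : AbstractSimplicialComplex (Fin r)) (m : Fin r → (Fin n →₀ ℕ))
    (a : Fin n →₀ ℕ) : Set (Finset (Fin r)) :=
  {σ | σ ∈ allFaces Δ ∧ σ.sup m ≤ a}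

theorem isLowerSet_facesBelow (Δ : AbstractSimplicialComplex (Fin r)) (m : Fin r → (Fin n →₀ ℕ))
    (a : Fin n →₀ ℕ) : IsLowerSet (facesBelow Δ m a) :=
  fun _ _ h hσ => ⟨allFaces_mono Δ hσ.1 h, (Finset.sup_mono h).trans hσ.2⟩

theorem facesBelow_join (ΔI : AbstractSimplicialComplex (Fin r))
    (ΔJ : AbstractSimplicialComplex (Fin s)) (mI : Fin r → (Fin n →₀ ℕ))
    (mJ : Fin s → (Fin n →₀ ℕ)) (a : Fin n →₀ ℕ) :
    facesBelow (join ΔI ΔJ) (Fin.append mI mJ) a =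
      joinSet (facesBelow ΔI mI a) (facesBelow ΔJ mJ a) := by
  ext ρ
  rw [← joinFace_joinEquiv_symm ρ, joinFace_mem_joinSet]
  simp only [facesBelow, Set.mem_ofPred_eq, joinFace_mem_allFaces_join, sup_joinFace, sup_le_iff]
  tauto

open Classical in
/-- Extension by zero of a function on the faces with `i` elements. -/
def extend (Δ : AbstractSimplicialComplex (Fin r)) (i : ℕ) (z : FacesOfCard Δ i → K)
    (σ : Finset (Fin r)) : K :=
  if h : σ ∈ allFaces Δ ∧ σ.card = i then z ⟨σ, h⟩ else 0

theorem extend_apply (Δ : AbstractSimplicialComplex (Fin r)) (i : ℕ) (z : FacesOfCard Δ i → K)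
    (σ : FacesOfCard Δ i) : extend Δ i z σ.1 = z σ :=
  dif_pos σ.2

theorem bd_extend (Δ : AbstractSimplicialComplex (Fin r)) (i : ℕ) (z : FacesOfCard Δ i → K)
    (τ : Finset (Fin r)) :
    bd K r (extend Δ i z) τ = ∑ σ : FacesOfCard Δ i, z σ * boundaryCoeff K σ.1 τ := by
  rw [bd_apply, ← sum_facesOfCard Δ i]
  · simp only [extend_apply]
  · intro σ hσ
    rw [extend, dif_neg hσ, zero_mul]

theorem bd_extend_eq_zero (Δ : AbstractSimplicialComplex (Fin r)) (i : ℕ)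
    (z : FacesOfCard Δ (i + 1) → K) {τ : Finset (Fin r)}
    (hτ : ¬(τ ∈ allFaces Δ ∧ τ.card = i)) : bd K r (extend Δ (i + 1) z) τ = 0 := by
  rw [bd_extend]
  refine Finset.sum_eq_zero fun σ _ => ?_
  by_contra hne
  have hne' := right_ne_zero_of_mul hne
  have h := card_of_boundaryCoeff_ne_zero hne'
  rw [σ.2.2] at h
  exact hτ ⟨allFaces_mono Δ σ.2.1 (subset_of_boundaryCoeff_ne_zero hne'), by omega⟩

theorem extend_mem_chains (Δ : AbstractSimplicialComplex (Fin r)) (m : Fin r → (Fin n →₀ ℕ))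
    (a : Fin n →₀ ℕ) (i : ℕ) (z : FacesOfCard Δ i → K) (hz : ∀ σ, z σ ≠ 0 → σ.1.sup m ≤ a) :
    extend Δ i z ∈ chains K (facesBelow Δ m a) := by
  intro σ hσ
  rw [extend]
  split_ifs with h
  · by_contra hne
    exact hσ ⟨h.1, hz _ hne⟩
  · rfl

/-- Strand exactness covers all degrees except that of the empty face; there the vertex `j` below
`a` supplies the missing preimage. -/
theorem acyclic_facesBelow (Δ : AbstractSimplicialComplex (Fin r)) (m : Fin r → (Fin n →₀ ℕ))
    (a : Fin n →₀ ℕ) (h : ∀ i, (simplicialFrame K Δ).StrandExact m i a) {j : Fin r}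
    (hj : m j ≤ a) : Acyclic K (facesBelow Δ m a) := by
  classical
  intro c hc hbc
  have h1 : ∀ k, ∃ w ∈ chains K (facesBelow Δ m a), bd K r w = part k c := by
    intro k
    cases k with
    | zero =>
      -- The boundary of `e_{j}` is `e_∅`, so `c ∅ • e_{j}` bounds the part of `c` on the empty
      -- face.
      refine ⟨Pi.single {j} (c ∅), fun σ hσ => ?_, funext fun τ => ?_⟩
      · refine Pi.single_eq_of_ne (fun h0 => hσ ?_) _
        rw [h0]
        exact ⟨Or.inr (Δ.singleton_mem j), by rwa [Finset.sup_singleton]⟩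
      · rw [bd_apply, Finset.sum_eq_single {j}, Pi.single_eq_same, part]
        · split_ifs with hτ
          · rw [Finset.card_eq_zero.mp hτ]
            simp [boundaryCoeff, sign, Finset.filter_singleton]
          · by_contra hne
            have := card_of_boundaryCoeff_ne_zero (right_ne_zero_of_mul hne)
            rw [Finset.card_singleton] at this
            omega
        · intro σ _ hσ
          rw [Pi.single_eq_of_ne hσ, zero_mul]
        · simp
    | succ i =>
      have hext : extend Δ (i + 1) (fun σ : FacesOfCard Δ (i + 1) => c σ.1) = part (i + 1) c := by
        funext σ
        rw [extend, part]
        split_ifs with h1 h2 h2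
        · rfl
        · exact absurd h1.2 h2
        · exact (hc σ fun h3 => h1 ⟨h3.1, h2⟩).symm
        · rfl
      obtain ⟨y, hy, hyc⟩ := (simplicialFrame_strandExact_iff Δ m i a).mp (h i)
        (fun σ => c σ.1) (fun σ hσ => by
          by_contra hle
          exact hσ (hc _ fun h' => hle h'.2)) (fun τ => by
          have h2 := bd_part (i + 1) c τ.1
          rw [hbc, ← hext, bd_extend] at h2
          simpa using h2)
      refine ⟨extend Δ (i + 1 + 1) y, extend_mem_chains Δ m a _ y hy, funext fun τ => ?_⟩
      rw [← hext, extend]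
      split_ifs with hτ
      · rw [bd_extend]
        exact hyc ⟨τ, hτ⟩
      · exact bd_extend_eq_zero Δ (i + 1) y hτ
  choose w hw hwc using h1
  refine ⟨∑ k ∈ Finset.range (r + 1), w k, Submodule.sum_mem _ fun k _ => hw k, ?_⟩
  rw [map_sum, Finset.sum_congr rfl fun k _ => hwc k, sum_part]

theorem strandExact_of_acyclic (Δ : AbstractSimplicialComplex (Fin r)) (m : Fin r → (Fin n →₀ ℕ))
    (a : Fin n →₀ ℕ) (h : Acyclic K (facesBelow Δ m a)) (i : ℕ) :
    (simplicialFrame K Δ).StrandExact m i a := by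
  rw [simplicialFrame_strandExact_iff]
  intro z hz hz0
  obtain ⟨w, hw, hwz⟩ := h (extend Δ (i + 1) z) (extend_mem_chains Δ m a _ z hz) (by
    funext τ
    by_cases hτ : τ ∈ allFaces Δ ∧ τ.card = i
    · rw [bd_extend]
      exact hz0 ⟨τ, hτ⟩
    · exact bd_extend_eq_zero Δ i z hτ)
  -- The primitive `w` may have parts in other cardinalities; they do not contribute to the boundary
  -- on faces with `i + 1` elements and are discarded.
  refine ⟨fun σ => w σ.1, fun σ hσ => ?_, fun τ => ?_⟩
  · by_contra hle
    exact hσ (hw _ fun h' => hle h'.2)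
  · have h1 : ∑ σ, w σ * boundaryCoeff K σ τ.1 = z τ := by
      rw [← bd_apply, hwz, extend_apply]
    rw [← h1]
    refine sum_facesOfCard Δ (i + 1 + 1) (fun σ => w σ * boundaryCoeff K σ τ.1) fun σ hσ => ?_
    by_contra hne
    have h3 := card_of_boundaryCoeff_ne_zero (right_ne_zero_of_mul hne)
    rw [τ.2.2] at h3
    refine hσ ⟨?_, h3⟩
    by_contra hσ'
    exact left_ne_zero_of_mul hne (hw σ fun h' => hσ' h'.1)

theorem strandExact_join (ΔI : AbstractSimplicialComplex (Fin r))
    (ΔJ : AbstractSimplicialComplex (Fin s)) (mI : Fin r → (Fin n →₀ ℕ))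
    (mJ : Fin s → (Fin n →₀ ℕ)) (a : Fin n →₀ ℕ)
    (hI : ∀ i, (simplicialFrame K ΔI).StrandExact mI i a)
    (hJ : ∀ i, (simplicialFrame K ΔJ).StrandExact mJ i a) (i : ℕ) :
    (simplicialFrame K (join ΔI ΔJ)).StrandExact (Fin.append mI mJ) i a := by
  by_cases h1 : ∃ j, mI j ≤ a
  · obtain ⟨j, hj⟩ := h1
    refine strandExact_of_acyclic _ _ _ ?_ i
    rw [facesBelow_join]
    exact (acyclic_facesBelow ΔI mI a hI hj).join_left (isLowerSet_facesBelow _ _ _)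
      (isLowerSet_facesBelow _ _ _)
  by_cases h2 : ∃ k, mJ k ≤ a
  · obtain ⟨k, hk⟩ := h2
    refine strandExact_of_acyclic _ _ _ ?_ i
    rw [facesBelow_join]
    exact (acyclic_facesBelow ΔJ mJ a hJ hk).join_right (isLowerSet_facesBelow _ _ _)
      (isLowerSet_facesBelow _ _ _)
  -- With no vertex below `a`, a chain on nonempty faces below `a` is zero.
  push Not at h1 h2
  rw [simplicialFrame_strandExact_iff]
  intro z hz _
  have hz0 : z = 0 := by
    funext σ
    by_contra hne
    have h3 := hz σ hne
    obtain ⟨x, hx⟩ : σ.1.Nonempty := by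
      rw [← Finset.card_pos, σ.2.2]
      omega
    have h4 := (Finset.le_sup (f := Fin.append mI mJ) hx).trans h3
    induction x using Fin.addCases with
    | left j => exact h1 j (by rwa [Fin.append_left] at h4)
    | right k => exact h2 k (by rwa [Fin.append_right] at h4)
  exact ⟨0, fun v hv => absurd rfl hv, fun u => by simp [hz0]⟩

/-! ### Coprimality of the generators -/

theorem monomial_mem_monomialSpan {S : Set (Fin n →₀ ℕ)} {a : Fin n →₀ ℕ} :
    monomial a (1 : K) ∈ monomialSpan K S ↔ ∃ b ∈ S, b ≤ a := by
  classical
  rw [monomialSpan, mem_ideal_span_monomial_image, support_monomial, if_neg one_ne_zero]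
  simp

theorem IsMinimalMonomialGenerators.eq_of_le {I : Ideal (MvPolynomial (Fin n) K)}
    {m : Fin r → (Fin n →₀ ℕ)} (h : IsMinimalMonomialGenerators I m) {i j : Fin r}
    (hij : m i ≤ m j) : i = j := by
  by_contra hne
  refine h.minimal (Set.range m \ {m j}) ⟨Set.sdiff_subset, fun hsub => ?_⟩ ?_
  · exact (hsub ⟨j, rfl⟩).2 rfl
  · rw [← h.span_eq]
    refine le_antisymm (Ideal.span_mono (Set.image_mono Set.sdiff_subset)) (Ideal.span_le.mpr ?_)
    rintro _ ⟨_, ⟨k, rfl⟩, rfl⟩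
    refine monomial_mem_monomialSpan.mpr ?_
    by_cases hk : m k = m j
    · exact ⟨m i, ⟨⟨i, rfl⟩, fun h' => hne (h.injective h')⟩, hij.trans hk.ge⟩
    · exact ⟨m k, ⟨⟨k, rfl⟩, hk⟩, le_rfl⟩

/-- A generating subset must contain a divisor of each `m j`, which in an antichain can only be `m
j` itself. -/
theorem IsMinimalMonomialGenerators.of_antichain {I : Ideal (MvPolynomial (Fin n) K)}
    {m : Fin r → (Fin n →₀ ℕ)} (hspan : monomialSpan K (Set.range m) = I)
    (h : ∀ i j, m i ≤ m j → i = j) : IsMinimalMonomialGenerators I m where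
  injective i j hij := h i j hij.le
  span_eq := hspan
  minimal S hS heq := by
    obtain ⟨_, ⟨j, rfl⟩, hj⟩ := Set.exists_of_ssubset hS
    have h1 : monomial (m j) (1 : K) ∈ monomialSpan K S := by
      rw [heq, ← hspan]
      exact monomial_mem_monomialSpan.mpr ⟨m j, ⟨j, rfl⟩, le_rfl⟩
    obtain ⟨b, hb, hbj⟩ := monomial_mem_monomialSpan.mp h1
    obtain ⟨i, rfl⟩ := hS.subset hb
    rw [h i j hbj] at hb
    exact hj hb

theorem monomialSpan_mul (S T : Set (Fin n →₀ ℕ)) :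
    monomialSpan K S * monomialSpan K T = monomialSpan K (Set.image2 (· + ·) S T) := by
  rw [monomialSpan, monomialSpan, Ideal.span_mul_span', monomialSpan]
  congr 1
  ext p
  constructor
  · rintro ⟨_, ⟨a, ha, rfl⟩, _, ⟨b, hb, rfl⟩, rfl⟩
    exact ⟨a + b, ⟨a, ha, b, hb, rfl⟩, by simp [monomial_mul]⟩
  · rintro ⟨_, ⟨a, ha, b, hb, rfl⟩, rfl⟩
    exact ⟨_, ⟨a, ha, rfl⟩, _, ⟨b, hb, rfl⟩, by simp [monomial_mul]⟩

/-- If `I ∩ J = I J` for monomial ideals, then the generators of `I` are coprime to those of `J`. -/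
theorem disjoint_of_inf_eq_mul {I J : Ideal (MvPolynomial (Fin n) K)}
    (hIJ : I ⊓ J = I * J) {mI : Fin r → (Fin n →₀ ℕ)} {mJ : Fin s → (Fin n →₀ ℕ)}
    (hI : IsMinimalMonomialGenerators I mI) (hJ : IsMinimalMonomialGenerators J mJ)
    (i : Fin r) (j : Fin s) (x : Fin n) : mI i x = 0 ∨ mJ j x = 0 := by
  -- The lcm of two generators lies in `I ∩ J = IJ`, so a product of generators divides it.
  have hlcm : ∀ i j, ∃ a b, mI a + mJ b ≤ mI i ⊔ mJ j := by
    intro i j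
    have h1 : monomial (mI i ⊔ mJ j) (1 : K) ∈ I * J := by
      rw [← hIJ, ← hI.span_eq, ← hJ.span_eq]
      exact ⟨monomial_mem_monomialSpan.mpr ⟨_, ⟨i, rfl⟩, le_sup_left⟩,
        monomial_mem_monomialSpan.mpr ⟨_, ⟨j, rfl⟩, le_sup_right⟩⟩
    rw [← hI.span_eq, ← hJ.span_eq, monomialSpan_mul, monomial_mem_monomialSpan] at h1
    obtain ⟨_, ⟨_, ⟨a, rfl⟩, _, ⟨b, rfl⟩, rfl⟩, h⟩ := h1
    exact ⟨a, b, h⟩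
  by_contra hbad
  -- Among the pairs that are not coprime, take one whose lcm has minimal degree.
  let bad : Set (Fin r × Fin s) := {p | ∃ x, ¬ (mI p.1 x = 0 ∨ mJ p.2 x = 0)}
  obtain ⟨⟨i, j⟩, ⟨x, hx⟩, hmin⟩ := Set.exists_min_image bad
    (fun p => (mI p.1 ⊔ mJ p.2).degree) (Set.toFinite _) ⟨(i, j), x, hbad⟩
  change ¬ (mI i x = 0 ∨ mJ j x = 0) at hx
  have hmin' : ∀ i' j', (i', j') ∈ bad → mI i' ⊔ mJ j' ≤ mI i ⊔ mJ j →
      mI i' ⊔ mJ j' = mI i ⊔ mJ j := by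
    intro i' j' hb hle
    have h1 := hmin (i', j') hb
    obtain ⟨c, hc⟩ := exists_add_of_le hle
    rw [hc] at h1 ⊢
    simp only [map_add] at h1
    have h2 : c.degree = 0 := by omega
    rw [Finsupp.degree_eq_zero_iff] at h2
    rw [h2, add_zero]
  obtain ⟨a, b, hab⟩ := hlcm i j
  have ha : mI a ≤ mI i ⊔ mJ j := le_self_add.trans hab
  have hb : mJ b ≤ mI i ⊔ mJ j := le_add_self.trans hab
  -- At a common variable `x` the exponent of the product exceeds that of the lcm.
  have hne : ¬ (a = i ∧ b = j) := by
    rintro ⟨rfl, rfl⟩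
    have := hab x
    simp only [Finsupp.add_apply, Finsupp.sup_apply] at this
    omega
  -- If `(a, b)` were not coprime, minimality would equate its lcm with that of `(i, j)`, and the
  -- product of `mI a` and `mJ b` would divide their own lcm.
  have hdisj : ∀ y, mI a y = 0 ∨ mJ b y = 0 := by
    by_contra! hex
    obtain ⟨y, hy⟩ := hex
    have h1 := hmin' a b ⟨y, by tauto⟩ (sup_le ha hb)
    have h2 := hab y
    rw [← h1] at h2
    simp only [Finsupp.add_apply, Finsupp.sup_apply] at h2
    omega
  -- If `mI a` were coprime to `mJ j`, it would divide `mI i`, hence equal it, although `mI i` is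
  -- not coprime to `mJ j`.
  have hA : (a, j) ∈ bad := by
    by_contra hnb
    have hd : ∀ y, mI a y = 0 ∨ mJ j y = 0 := by
      intro y
      by_contra hy
      exact hnb ⟨y, hy⟩
    have hle : mI a ≤ mI i := fun y => by
      have h1 := ha y
      rw [Finsupp.sup_apply] at h1
      rcases hd y with h | h <;> omega
    have := hI.eq_of_le hle
    subst this
    exact hx (hd x)
  have hB : (i, b) ∈ bad := by
    by_contra hnb
    have hd : ∀ y, mI i y = 0 ∨ mJ b y = 0 := by
      intro y
      by_contra hy
      exact hnb ⟨y, hy⟩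
    have hle : mJ b ≤ mJ j := fun y => by
      have h1 := hb y
      rw [Finsupp.sup_apply] at h1
      rcases hd y with h | h <;> omega
    have := hJ.eq_of_le hle
    subst this
    exact hx (hd x)
  -- By minimality the pairs `(a, j)`, `(i, b)` and `(i, j)` share one lcm. As `mI a` and `mJ b` are
  -- coprime, comparing exponents gives `mI a ∣ mI i` and `mJ b ∣ mJ j`, so `a = i` and `b = j`.
  have hAeq := hmin' a j hA (sup_le ha le_sup_right)
  have hBeq := hmin' i b hB (sup_le le_sup_left hb)
  refine hne ⟨hI.eq_of_le fun y => ?_, hJ.eq_of_le fun y => ?_⟩ <;>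
  · have h1 := DFunLike.congr_fun hAeq y
    have h2 := DFunLike.congr_fun hBeq y
    simp only [Finsupp.sup_apply] at h1 h2
    rcases hdisj y with h | h <;> omega

theorem IsMinimalMonomialGenerators.append {I J : Ideal (MvPolynomial (Fin n) K)}
    {mI : Fin r → (Fin n →₀ ℕ)} {mJ : Fin s → (Fin n →₀ ℕ)}
    (hI : IsMinimalMonomialGenerators I mI) (hJ : IsMinimalMonomialGenerators J mJ)
    (hI0 : ∀ i, mI i ≠ 0) (hJ0 : ∀ j, mJ j ≠ 0) (hd : ∀ i j x, mI i x = 0 ∨ mJ j x = 0) :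
    IsMinimalMonomialGenerators (I ⊔ J) (Fin.append mI mJ) := by
  refine .of_antichain ?_ ?_
  · rw [← hI.span_eq, ← hJ.span_eq, monomialSpan, monomialSpan, monomialSpan, ← Ideal.span_union,
      ← Set.image_union]
    congr 2
    ext a
    constructor
    · rintro ⟨k, rfl⟩
      induction k using Fin.addCases with
      | left i => exact Or.inl ⟨i, (Fin.append_left _ _ _).symm⟩
      | right j => exact Or.inr ⟨j, (Fin.append_right _ _ _).symm⟩
    · rintro (⟨i, rfl⟩ | ⟨j, rfl⟩)
      · exact ⟨_, Fin.append_left _ _ i⟩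
      · exact ⟨_, Fin.append_right _ _ j⟩
  · intro k l hkl
    induction k using Fin.addCases with
    | left i =>
      induction l using Fin.addCases with
      | left i' =>
        rw [Fin.append_left, Fin.append_left] at hkl
        rw [hI.eq_of_le hkl]
      | right j =>
        rw [Fin.append_left, Fin.append_right] at hkl
        refine absurd (Finsupp.ext fun x => ?_) (hI0 i)
        have := hkl x
        rw [Finsupp.zero_apply]
        rcases hd i j x with h | h <;> omega
    | right j =>
      induction l using Fin.addCases with
      | left i =>
        rw [Fin.append_left, Fin.append_right] at hkl
        refine absurd (Finsupp.ext fun x => ?_) (hJ0 j)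
        have := hkl x
        rw [Finsupp.zero_apply]
        rcases hd i j x with h | h <;> omega
      | right j' =>
        rw [Fin.append_right, Fin.append_right] at hkl
        rw [hJ.eq_of_le hkl]

/-! ### The resolution of the sum -/

/-- The labelled complex has no two comparable faces of the same label. -/
def IsMinimalLabelling (Δ : AbstractSimplicialComplex (Fin r)) (m : Fin r → (Fin n →₀ ℕ)) : Prop :=
  ∀ σ ∈ allFaces Δ, ∀ j ∈ σ, (σ.erase j).sup m ≠ σ.sup m

theorem isMinimalLabelling_iff (Δ : AbstractSimplicialComplex (Fin r))
    (m : Fin r → (Fin n →₀ ℕ)) : IsMinimalLabelling Δ m ↔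
      ∀ i v u, (simplicialFrame K Δ).coeff i v u ≠ 0 →
        (simplicialFrame K Δ).mdeg m i u ≠ (simplicialFrame K Δ).mdeg m (i + 1) v := by
  constructor
  · intro h i v u hc
    rw [simplicialFrame_mdeg Δ m i u, simplicialFrame_mdeg Δ m (i + 1) v]
    obtain ⟨j, hj, hju⟩ := exists_of_boundaryCoeff_ne_zero hc
    rw [hju]
    exact h v.1 v.2.1 j hj
  · intro h σ hσ j hj
    have h1 := h (σ.erase j).card ⟨σ, hσ, (Finset.card_erase_add_one hj).symm⟩
      ⟨σ.erase j, allFaces_mono Δ hσ (Finset.erase_subset _ _), rfl⟩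
      (boundaryCoeff_erase_ne_zero hj)
    rwa [simplicialFrame_mdeg, simplicialFrame_mdeg] at h1

/-- Forwards, exactness and minimality are carried along the isomorphism. Backwards, the
homogenization is itself the resolution. -/
theorem minimalResolutionSupportedBy_iff (I : Ideal (MvPolynomial (Fin n) K))
    (m : Fin r → (Fin n →₀ ℕ)) (Δ : AbstractSimplicialComplex (Fin r)) :
    MinimalResolutionSupportedBy I m Δ ↔ IsMinimalMonomialGenerators I m ∧
      (∀ i a, (simplicialFrame K Δ).StrandExact m i a) ∧ IsMinimalLabelling Δ m := by
  constructor
  · rintro ⟨hm, F, hF, hiso⟩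
    refine ⟨hm, fun i a => .of_exact (U := simplicialFrame K Δ)
      (hiso.exact i (hF.exact i)) a, ?_⟩
    rw [isMinimalLabelling_iff (K := K)]
    exact fun i => (Frame.range_d_le_iff i).mp (hiso.range_d_le i _ (hF.minimal i))
  · rintro ⟨hm, hex, hmin⟩
    refine ⟨hm, (simplicialFrame K Δ).homogenization m, ⟨fun i => Frame.exact_of_strandExact (hex i),
      Frame.exists_augmentation (U := simplicialFrame K Δ) hm.span_eq, fun i => (Frame.range_d_le_iff i).mpr
        ((isMinimalLabelling_iff Δ m).mp hmin i)⟩, Iso.refl _, ?_, ?_⟩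
    · exact fun _ _ _ h => h
    · exact fun _ _ _ h => h

/-- A vertex must not share the label `1` of its only facet, the empty face. -/
theorem IsMinimalLabelling.ne_zero {Δ : AbstractSimplicialComplex (Fin r)}
    {m : Fin r → (Fin n →₀ ℕ)} (h : IsMinimalLabelling Δ m) (j : Fin r) : m j ≠ 0 := by
  have h1 := h {j} (Or.inr (Δ.singleton_mem j)) j (Finset.mem_singleton_self j)
  rw [Finset.sup_singleton, Finset.erase_singleton, Finset.sup_empty] at h1
  exact h1.symm

theorem sup_apply_eq_zero {σ : Finset (Fin r)} {m : Fin r → (Fin n →₀ ℕ)} {x : Fin n}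
    (h : ∀ j ∈ σ, m j x = 0) : σ.sup m x = 0 := by
  classical
  induction σ using Finset.induction_on with
  | empty => rfl
  | insert j σ _ ih =>
    rw [Finset.sup_insert, Finsupp.sup_apply, h j (Finset.mem_insert_self j σ),
      ih fun k hk => h k (Finset.mem_insert_of_mem hk)]
    rfl

theorem IsMinimalLabelling.join {ΔI : AbstractSimplicialComplex (Fin r)}
    {ΔJ : AbstractSimplicialComplex (Fin s)} {mI : Fin r → (Fin n →₀ ℕ)}
    {mJ : Fin s → (Fin n →₀ ℕ)} (hI : IsMinimalLabelling ΔI mI) (hJ : IsMinimalLabelling ΔJ mJ)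
    (hd : ∀ i j x, mI i x = 0 ∨ mJ j x = 0) :
    IsMinimalLabelling (join ΔI ΔJ) (Fin.append mI mJ) := by
  intro ρ hρ
  rw [← joinFace_joinEquiv_symm ρ] at hρ ⊢
  generalize ((joinEquiv r s).symm ρ).1 = σ, ((joinEquiv r s).symm ρ).2 = τ at hρ ⊢
  obtain ⟨hσ, hτ⟩ := joinFace_mem_allFaces_join.mp hρ
  -- Coprimality of the generators passes to the labels of `σ` and `τ`.
  have hd' : ∀ x, σ.sup mI x = 0 ∨ τ.sup mJ x = 0 := by
    intro x
    by_cases h : ∀ j ∈ σ, mI j x = 0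
    · exact Or.inl (sup_apply_eq_zero h)
    · push Not at h
      obtain ⟨j, _, hj⟩ := h
      exact Or.inr (sup_apply_eq_zero fun k _ => (hd j k x).resolve_left hj)
  intro x hx heq
  induction x using Fin.addCases with
  | left j =>
    rw [joinFace_erase_castAdd, sup_joinFace, sup_joinFace] at heq
    refine hI σ hσ j (castAdd_mem_joinFace.mp hx) (Finsupp.ext fun y => ?_)
    have h1 := DFunLike.congr_fun heq y
    have h2 : (σ.erase j).sup mI y ≤ σ.sup mI y :=
      Finsupp.le_def.mp (Finset.sup_mono (Finset.erase_subset j σ)) y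
    simp only [Finsupp.sup_apply] at h1
    rcases hd' y with h | h <;> omega
  | right k =>
    rw [joinFace_erase_natAdd, sup_joinFace, sup_joinFace] at heq
    refine hJ τ hτ k (natAdd_mem_joinFace.mp hx) (Finsupp.ext fun y => ?_)
    have h1 := DFunLike.congr_fun heq y
    have h2 : (τ.erase k).sup mJ y ≤ τ.sup mJ y :=
      Finsupp.le_def.mp (Finset.sup_mono (Finset.erase_subset k τ)) y
    simp only [Finsupp.sup_apply] at h1
    rcases hd' y with h | h <;> omega

theorem MinimalResolutionSupportedBy.join {I J : Ideal (MvPolynomial (Fin n) K)}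
    (hIJ : I ⊓ J = I * J) {mI : Fin r → (Fin n →₀ ℕ)} {mJ : Fin s → (Fin n →₀ ℕ)}
    {ΔI : AbstractSimplicialComplex (Fin r)} {ΔJ : AbstractSimplicialComplex (Fin s)}
    (hI : MinimalResolutionSupportedBy I mI ΔI) (hJ : MinimalResolutionSupportedBy J mJ ΔJ) :
    MinimalResolutionSupportedBy (I ⊔ J) (Fin.append mI mJ) (join ΔI ΔJ) := by
  rw [minimalResolutionSupportedBy_iff] at hI hJ ⊢
  obtain ⟨hmI, heI, hlI⟩ := hI
  obtain ⟨hmJ, heJ, hlJ⟩ := hJ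
  have hd := disjoint_of_inf_eq_mul hIJ hmI hmJ
  exact ⟨hmI.append hmJ hlI.ne_zero hlJ.ne_zero hd,
    fun i a => strandExact_join ΔI ΔJ mI mJ a (fun i => heI i a) (fun i => heJ i a) i,
    hlI.join hlJ hd⟩

/-! ### The chain complex of a join -/

theorem extend_matrixMap (Δ : AbstractSimplicialComplex (Fin r)) (i : ℕ)
    (x : FacesOfCard Δ (i + 1) →₀ K) :
    extend Δ i (matrixMap (fun σ τ => boundaryCoeff K σ.1 τ.1) x) =
      bd K r (extend Δ (i + 1) x) := by
  funext τ
  rw [extend]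
  split_ifs with hτ
  · rw [bd_extend]
    exact matrixMap_apply _ _ _
  · exact (bd_extend_eq_zero Δ i x hτ).symm

theorem bd_extend_zero (Δ : AbstractSimplicialComplex (Fin r)) (x : FacesOfCard Δ 0 → K) :
    bd K r (extend Δ 0 x) = 0 := by
  funext τ
  rw [bd_extend]
  refine Finset.sum_eq_zero fun σ _ => ?_
  by_contra hne
  have h3 := card_of_boundaryCoeff_ne_zero (right_ne_zero_of_mul hne)
  rw [σ.2.2] at h3
  omega

theorem extend_add (Δ : AbstractSimplicialComplex (Fin r)) (i : ℕ) (x y : FacesOfCard Δ i → K)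
    (σ : Finset (Fin r)) : extend Δ i (x + y) σ = extend Δ i x σ + extend Δ i y σ := by
  simp only [extend]
  split_ifs <;> simp

theorem extend_smul (Δ : AbstractSimplicialComplex (Fin r)) (i : ℕ) (k : K)
    (x : FacesOfCard Δ i → K) (σ : Finset (Fin r)) :
    extend Δ i (k • x) σ = k * extend Δ i x σ := by
  simp only [extend]
  split_ifs <;> simp

theorem simplicialFrame_complex_d (Δ : AbstractSimplicialComplex (Fin r)) (i : ℕ) :
    (chainComplex K Δ).d (i + 1) i = ModuleCat.ofHom
      (matrixMap fun (σ : FacesOfCard Δ (i + 1)) (τ : FacesOfCard Δ i) =>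
        boundaryCoeff K σ.1 τ.1) :=
  matrixComplex_d _ _ (simplicialFrame K Δ).coeff_comp i

variable (ΔI : AbstractSimplicialComplex (Fin r)) (ΔJ : AbstractSimplicialComplex (Fin s))

open TensorProduct

/-- The image of `x ⊗ y` under `e_σ ⊗ e_τ ↦ e_{σ ∪ τ}`. -/
def joinProd {p q : ℕ} (n : ℕ) (x : FacesOfCard ΔI p →₀ K) (y : FacesOfCard ΔJ q →₀ K) :
    FacesOfCard (join ΔI ΔJ) n →₀ K :=
  Finsupp.equivFunOnFinite.symm fun ρ =>
    extend ΔI p x ((joinEquiv r s).symm ρ.1).1 * extend ΔJ q y ((joinEquiv r s).symm ρ.1).2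

theorem joinProd_apply {p q n : ℕ} (x : FacesOfCard ΔI p →₀ K) (y : FacesOfCard ΔJ q →₀ K)
    (ρ : FacesOfCard (join ΔI ΔJ) n) : joinProd ΔI ΔJ n x y ρ =
      extend ΔI p x ((joinEquiv r s).symm ρ.1).1 * extend ΔJ q y ((joinEquiv r s).symm ρ.1).2 :=
  rfl

/-- The map `e_σ ⊗ e_τ ↦ e_{σ ∪ τ}`. -/
def joinMap (K : Type u) [Field K] (p q n : ℕ) :
    (FacesOfCard ΔI p →₀ K) ⊗[K] (FacesOfCard ΔJ q →₀ K) →ₗ[K]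
      (FacesOfCard (join ΔI ΔJ) n →₀ K) :=
  TensorProduct.lift <| LinearMap.mk₂ K (joinProd ΔI ΔJ n)
    (fun x x' y => Finsupp.ext fun ρ => by
      rw [Finsupp.add_apply, joinProd_apply, joinProd_apply, joinProd_apply, Finsupp.coe_add,
        extend_add, add_mul])
    (fun k x y => Finsupp.ext fun ρ => by
      rw [Finsupp.smul_apply, joinProd_apply, joinProd_apply, Finsupp.coe_smul, extend_smul,
        smul_eq_mul, mul_assoc])
    (fun x y y' => Finsupp.ext fun ρ => by
      rw [Finsupp.add_apply, joinProd_apply, joinProd_apply, joinProd_apply, Finsupp.coe_add,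
        extend_add, mul_add])
    (fun k x y => Finsupp.ext fun ρ => by
      rw [Finsupp.smul_apply, joinProd_apply, joinProd_apply, Finsupp.coe_smul, extend_smul,
        smul_eq_mul, mul_left_comm])

theorem joinMap_tmul_apply {p q n : ℕ} (x : FacesOfCard ΔI p →₀ K) (y : FacesOfCard ΔJ q →₀ K)
    (ρ : FacesOfCard (join ΔI ΔJ) n) : joinMap ΔI ΔJ K p q n (x ⊗ₜ y) ρ =
      extend ΔI p x ((joinEquiv r s).symm ρ.1).1 * extend ΔJ q y ((joinEquiv r s).symm ρ.1).2 :=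
  rfl

/-- `joinMap` leaves `n` independent of `p` and `q`, which avoids casts between index types, and
vanishes when `p + q ≠ n`; hence the hypothesis `h`. -/
theorem extend_joinMap {p q n : ℕ} (h : p + q = n) (x : FacesOfCard ΔI p →₀ K)
    (y : FacesOfCard ΔJ q →₀ K) (σ : Finset (Fin r)) (τ : Finset (Fin s)) :
    extend (join ΔI ΔJ) n (joinMap ΔI ΔJ K p q n (x ⊗ₜ y)) (joinFace σ τ) =
      extend ΔI p x σ * extend ΔJ q y τ := by
  rw [extend]
  split_ifs with hρ
  · rw [joinMap_tmul_apply, joinEquiv_symm_joinFace]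
  · rw [joinFace_mem_allFaces_join, card_joinFace] at hρ
    rw [extend, extend]
    split_ifs with h1 h2
    · exact absurd ⟨⟨h1.1, h2.1⟩, by rw [h1.2, h2.2, h]⟩ hρ
    all_goals simp

theorem bd_extend_joinMap {p q n : ℕ} (h : p + q = n) (x : FacesOfCard ΔI p →₀ K)
    (y : FacesOfCard ΔJ q →₀ K) (σ : Finset (Fin r)) (τ : Finset (Fin s)) :
    bd K (r + s) (extend (join ΔI ΔJ) n (joinMap ΔI ΔJ K p q n (x ⊗ₜ y))) (joinFace σ τ) =
      bd K r (extend ΔI p x) σ * extend ΔJ q y τ +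
        (-1) ^ p * (extend ΔI p x σ * bd K s (extend ΔJ q y) τ) := by
  rw [bd_joinFace]
  simp only [extend_joinMap ΔI ΔJ h]
  congr 1
  · simp only [bd_apply, Finset.sum_mul]
    exact Finset.sum_congr rfl fun _ _ => by ring
  · have h1 : bd K s (fun τ' => extend ΔI p x σ * extend ΔJ q y τ') τ =
        extend ΔI p x σ * bd K s (extend ΔJ q y) τ := by
      simp only [bd_apply, Finset.mul_sum]
      exact Finset.sum_congr rfl fun _ _ => by ring
    rw [h1]
    -- The signs `(-1)^|σ|` and `(-1)^p` agree wherever the extension of `x` does not vanish.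
    by_cases hσ : σ ∈ allFaces ΔI ∧ σ.card = p
    · rw [hσ.2]
    · rw [extend, dif_neg hσ]
      simp

theorem joinMap_single {p q n : ℕ} (h : p + q = n) (σ : FacesOfCard ΔI p) (τ : FacesOfCard ΔJ q) :
    joinMap ΔI ΔJ K p q n (Finsupp.single σ 1 ⊗ₜ Finsupp.single τ 1) =
      Finsupp.single ⟨joinFace σ.1 τ.1, joinFace_mem_allFaces_join.mpr ⟨σ.2.1, τ.2.1⟩, by
        rw [card_joinFace, σ.2.2, τ.2.2, h]⟩ 1 := by
  classical
  ext ⟨ρ, hρ⟩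
  obtain ⟨σ', τ', rfl⟩ : ∃ σ' τ', joinFace σ' τ' = ρ := ⟨_, _, joinFace_joinEquiv_symm ρ⟩
  rw [joinMap_tmul_apply, joinEquiv_symm_joinFace, Finsupp.single_apply]
  simp only [Subtype.mk.injEq, joinFace_inj]
  by_cases h1 : σ.1 = σ'
  · by_cases h2 : τ.1 = τ'
    · subst h1 h2
      rw [extend_apply, extend_apply]
      simp
    · rw [if_neg (fun h' => h2 h'.2)]
      have : extend ΔJ q (Finsupp.single τ (1 : K)) τ' = 0 := by
        rw [extend]
        split_ifs with h3
        · exact Finsupp.single_eq_of_ne fun h4 => h2 (congrArg Subtype.val h4).symm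
        · rfl
      rw [this, mul_zero]
  · rw [if_neg (fun h' => h1 h'.1)]
    have : extend ΔI p (Finsupp.single σ (1 : K)) σ' = 0 := by
      rw [extend]
      split_ifs with h3
      · exact Finsupp.single_eq_of_ne fun h4 => h1 (congrArg Subtype.val h4).symm
      · rfl
    rw [this, zero_mul]

/-- The tensor product of the chain complexes of two simplicial complexes. -/
abbrev tensorComplex (K : Type u) [Field K] : ChainComplex (ModuleCat.{u} K) ℕ :=
  HomologicalComplex.tensorObj (chainComplex K ΔI) (chainComplex K ΔJ)

/-- The inclusion of a summand of the tensor product. -/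
def inclusion (K : Type u) [Field K] (p q n : ℕ) (h : p + q = n) :
    (FacesOfCard ΔI p →₀ K) ⊗[K] (FacesOfCard ΔJ q →₀ K) →ₗ[K] (tensorComplex ΔI ΔJ K).X n :=
  (HomologicalComplex.ιTensorObj (chainComplex K ΔI) (chainComplex K ΔJ) p q n h).hom

theorem tensorComplex_hom_ext {n : ℕ} {M : Type u} [AddCommGroup M] [Module K M]
    {f g : (tensorComplex ΔI ΔJ K).X n →ₗ[K] M}
    (hfg : ∀ p q h x y, f (inclusion ΔI ΔJ K p q n h (x ⊗ₜ y)) =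
      g (inclusion ΔI ΔJ K p q n h (x ⊗ₜ y))) : f = g := by
  have h1 : ModuleCat.ofHom f = ModuleCat.ofHom g := by
    refine HomologicalComplex.mapBifunctor.hom_ext fun p q h => ModuleCat.hom_ext ?_
    exact TensorProduct.ext' fun x y => hfg p q h x y
  exact congrArg ModuleCat.Hom.hom h1

/-- The map `e_σ ⊗ e_τ ↦ e_{σ ∪ τ}` on the tensor product of complexes. -/
def tensorToJoin (K : Type u) [Field K] (n : ℕ) :
    (tensorComplex ΔI ΔJ K).X n →ₗ[K] (FacesOfCard (join ΔI ΔJ) n →₀ K) :=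
  (HomologicalComplex.mapBifunctorDesc (K₁ := chainComplex K ΔI) (K₂ := chainComplex K ΔJ)
    (F := MonoidalCategory.curriedTensor (ModuleCat.{u} K)) (c := ComplexShape.down ℕ) (j := n)
    (A := ModuleCat.of K (FacesOfCard (join ΔI ΔJ) n →₀ K))
    fun p q _ => ModuleCat.ofHom (joinMap ΔI ΔJ K p q n)).hom

theorem tensorToJoin_inclusion {p q n : ℕ} (h : p + q = n)
    (x : (FacesOfCard ΔI p →₀ K) ⊗[K] (FacesOfCard ΔJ q →₀ K)) :
    tensorToJoin ΔI ΔJ K n (inclusion ΔI ΔJ K p q n h x) = joinMap ΔI ΔJ K p q n x := by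
  have h1 := HomologicalComplex.ι_mapBifunctorDesc (K₁ := chainComplex K ΔI)
    (K₂ := chainComplex K ΔJ)
    (F := MonoidalCategory.curriedTensor (ModuleCat.{u} K)) (c := ComplexShape.down ℕ) (j := n)
    (A := ModuleCat.of K (FacesOfCard (join ΔI ΔJ) n →₀ K))
    (fun p q _ => ModuleCat.ofHom (joinMap ΔI ΔJ K p q n)) p q h
  exact congrArg (fun f => f.hom x) h1

/-- The basis vector `e_σ ⊗ e_τ` of the tensor product of complexes. -/
def tensorBasis (K : Type u) [Field K] {n : ℕ} (σ : Finset (Fin r)) (τ : Finset (Fin s))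
    (hσ : σ ∈ allFaces ΔI) (hτ : τ ∈ allFaces ΔJ) (h : σ.card + τ.card = n) :
    (tensorComplex ΔI ΔJ K).X n :=
  inclusion ΔI ΔJ K σ.card τ.card n h
    (Finsupp.single ⟨σ, hσ, rfl⟩ 1 ⊗ₜ Finsupp.single ⟨τ, hτ, rfl⟩ 1)

/-- `tensorBasis` takes its summand index from the cardinalities of the faces, so that it can be
evaluated at the two parts of a face of the join; this lemma returns to arbitrary `p` and `q`. -/
theorem inclusion_single {p q n : ℕ} (h : p + q = n) (σ : FacesOfCard ΔI p)
    (τ : FacesOfCard ΔJ q) :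
    inclusion ΔI ΔJ K p q n h (Finsupp.single σ 1 ⊗ₜ Finsupp.single τ 1) =
      tensorBasis ΔI ΔJ K σ.1 τ.1 σ.2.1 τ.2.1 (by rw [σ.2.2, τ.2.2, h]) := by
  obtain ⟨σ, hσ, rfl⟩ := σ
  obtain ⟨τ, hτ, rfl⟩ := τ
  rfl

theorem mem_allFaces_of_joinEquiv_symm {ΔI : AbstractSimplicialComplex (Fin r)}
    {ΔJ : AbstractSimplicialComplex (Fin s)} {ρ : Finset (Fin (r + s))}
    (hρ : ρ ∈ allFaces (join ΔI ΔJ)) :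
    ((joinEquiv r s).symm ρ).1 ∈ allFaces ΔI ∧ ((joinEquiv r s).symm ρ).2 ∈ allFaces ΔJ := by
  rw [← joinFace_joinEquiv_symm ρ] at hρ
  exact joinFace_mem_allFaces_join.mp hρ

theorem card_joinEquiv_symm (ρ : Finset (Fin (r + s))) :
    ((joinEquiv r s).symm ρ).1.card + ((joinEquiv r s).symm ρ).2.card = ρ.card := by
  rw [← card_joinFace, joinFace_joinEquiv_symm]

/-- The map `e_{σ ∪ τ} ↦ e_σ ⊗ e_τ`. -/
def joinToTensor (K : Type u) [Field K] (n : ℕ) :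
    (FacesOfCard (join ΔI ΔJ) n →₀ K) →ₗ[K] (tensorComplex ΔI ΔJ K).X n :=
  Finsupp.linearCombination K fun ρ => tensorBasis ΔI ΔJ K ((joinEquiv r s).symm ρ.1).1
    ((joinEquiv r s).symm ρ.1).2 (mem_allFaces_of_joinEquiv_symm ρ.2.1).1
    (mem_allFaces_of_joinEquiv_symm ρ.2.1).2 ((card_joinEquiv_symm ρ.1).trans ρ.2.2)

theorem tensorBasis_congr {n : ℕ} {σ σ' : Finset (Fin r)} {τ τ' : Finset (Fin s)}
    (hσσ' : σ = σ') (hττ' : τ = τ') (hσ : σ ∈ allFaces ΔI) (hτ : τ ∈ allFaces ΔJ)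
    (h : σ.card + τ.card = n) : tensorBasis ΔI ΔJ K σ τ hσ hτ h =
      tensorBasis ΔI ΔJ K σ' τ' (hσσ' ▸ hσ) (hττ' ▸ hτ) (hσσ' ▸ hττ' ▸ h) := by
  subst hσσ' hττ'
  rfl

theorem joinToTensor_tensorToJoin (n : ℕ) :
    joinToTensor ΔI ΔJ K n ∘ₗ tensorToJoin ΔI ΔJ K n = LinearMap.id := by
  refine tensorComplex_hom_ext ΔI ΔJ fun p q h x y => ?_
  have h1 : joinToTensor ΔI ΔJ K n ∘ₗ tensorToJoin ΔI ΔJ K n ∘ₗ inclusion ΔI ΔJ K p q n h =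
      inclusion ΔI ΔJ K p q n h := by
    ext σ τ
    have e := joinEquiv_symm_joinFace σ.1 τ.1
    simp only [AlgebraTensorModule.curry_apply, curry_apply, LinearMap.coe_comp,
      Function.comp_apply, Finsupp.lsingle_apply,
      LinearMap.restrictScalars_self]
    rw [tensorToJoin_inclusion, joinMap_single ΔI ΔJ h, joinToTensor,
      Finsupp.linearCombination_single, one_smul, inclusion_single]
    exact tensorBasis_congr ΔI ΔJ (congrArg Prod.fst e) (congrArg Prod.snd e) _ _ _
  exact LinearMap.congr_fun h1 (x ⊗ₜ y)

theorem tensorToJoin_joinToTensor (n : ℕ) :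
    tensorToJoin ΔI ΔJ K n ∘ₗ joinToTensor ΔI ΔJ K n = LinearMap.id := by
  refine Finsupp.lhom_ext' fun ρ => LinearMap.ext_ring ?_
  simp only [LinearMap.coe_comp, Function.comp_apply, Finsupp.lsingle_apply, LinearMap.id_apply]
  rw [joinToTensor, Finsupp.linearCombination_single, one_smul, tensorBasis,
    tensorToJoin_inclusion, joinMap_single ΔI ΔJ ((card_joinEquiv_symm ρ.1).trans ρ.2.2)]
  congr 1
  exact Subtype.ext (joinFace_joinEquiv_symm ρ.1)

theorem tensorToJoin_d₁ {p q n : ℕ} (h : p + q = n + 1) (x : FacesOfCard ΔI p →₀ K)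
    (y : FacesOfCard ΔJ q →₀ K) (ρ : FacesOfCard (join ΔI ΔJ) n) :
    tensorToJoin ΔI ΔJ K n ((HomologicalComplex.mapBifunctor.d₁ (chainComplex K ΔI)
      (chainComplex K ΔJ) (MonoidalCategory.curriedTensor (ModuleCat.{u} K))
      (ComplexShape.down ℕ) p q n).hom (x ⊗ₜ y)) ρ =
      bd K r (extend ΔI p x) ((joinEquiv r s).symm ρ.1).1 *
        extend ΔJ q y ((joinEquiv r s).symm ρ.1).2 := by
  cases p with
  | zero =>
    -- Nothing leaves homological degree `0`, and the boundary of a multiple of `e_∅` is zero.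
    rw [HomologicalComplex.mapBifunctor.d₁_eq_zero _ _ _ _ _ _ _ (by simp), bd_extend_zero]
    rw [ModuleCat.hom_zero, LinearMap.zero_apply, map_zero]
    simp
  | succ p =>
    have h' : p + q = n := by omega
    rw [HomologicalComplex.mapBifunctor.d₁_eq _ _ _ _
      (show (ComplexShape.down ℕ).Rel (p + 1) p from rfl) q n h', simplicialFrame_complex_d,
      ← extend_matrixMap, ← joinMap_tmul_apply, ← tensorToJoin_inclusion ΔI ΔJ h',
      show ComplexShape.ε₁ (ComplexShape.down ℕ) (ComplexShape.down ℕ) (ComplexShape.down ℕ)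
        (p + 1, q) = 1 from rfl, one_smul]
    rfl

theorem tensorToJoin_d₂ {p q n : ℕ} (h : p + q = n + 1) (x : FacesOfCard ΔI p →₀ K)
    (y : FacesOfCard ΔJ q →₀ K) (ρ : FacesOfCard (join ΔI ΔJ) n) :
    tensorToJoin ΔI ΔJ K n ((HomologicalComplex.mapBifunctor.d₂ (chainComplex K ΔI)
      (chainComplex K ΔJ) (MonoidalCategory.curriedTensor (ModuleCat.{u} K))
      (ComplexShape.down ℕ) p q n).hom (x ⊗ₜ y)) ρ =
      (-1) ^ p * (extend ΔI p x ((joinEquiv r s).symm ρ.1).1 *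
        bd K s (extend ΔJ q y) ((joinEquiv r s).symm ρ.1).2) := by
  cases q with
  | zero =>
    rw [HomologicalComplex.mapBifunctor.d₂_eq_zero _ _ _ _ _ _ _ (by simp), bd_extend_zero]
    rw [ModuleCat.hom_zero, LinearMap.zero_apply, map_zero]
    simp
  | succ q =>
    have h' : p + q = n := by omega
    rw [HomologicalComplex.mapBifunctor.d₂_eq _ _ _ _ p
      (show (ComplexShape.down ℕ).Rel (q + 1) q from rfl) n h', simplicialFrame_complex_d,
      ← extend_matrixMap, ← joinMap_tmul_apply, ← tensorToJoin_inclusion ΔI ΔJ h',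
      show ComplexShape.ε₂ (ComplexShape.down ℕ) (ComplexShape.down ℕ) (ComplexShape.down ℕ)
        (p, q + 1) = (-1) ^ p from rfl]
    rcases Nat.even_or_odd p with hp | hp
    · rw [hp.neg_one_pow, hp.neg_one_pow, one_smul, one_mul]
      rfl
    · rw [hp.neg_one_pow, hp.neg_one_pow, Units.neg_smul, one_smul, neg_one_mul,
        ModuleCat.hom_neg, LinearMap.neg_apply, map_neg, Finsupp.neg_apply]
      rfl

/-- The isomorphism `C(ΔI) ⊗ C(ΔJ) ≅ C(ΔI * ΔJ)`. -/
def tensorIsoJoin (K : Type u) [Field K] :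
    tensorComplex ΔI ΔJ K ≅ chainComplex K (join ΔI ΔJ) :=
  HomologicalComplex.Hom.isoOfComponents
    (fun n => LinearEquiv.toModuleIso (X₁ := (tensorComplex ΔI ΔJ K).X n)
      (X₂ := FacesOfCard (join ΔI ΔJ) n →₀ K) (LinearEquiv.ofLinearMap (tensorToJoin ΔI ΔJ K n)
        (joinToTensor ΔI ΔJ K n) (tensorToJoin_joinToTensor ΔI ΔJ n)
        (joinToTensor_tensorToJoin ΔI ΔJ n)))
    (by
      rintro _ n rfl
      rw [simplicialFrame_complex_d]
      refine ModuleCat.hom_ext (tensorComplex_hom_ext ΔI ΔJ fun p q h x y => ?_)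
      refine Finsupp.ext fun (ρ : FacesOfCard (join ΔI ΔJ) n) => ?_
      -- On a summand the total differential is the sum of the two partial ones, which match the two
      -- terms of the Leibniz rule.
      have hd : ((tensorComplex ΔI ΔJ K).d (n + 1) n).hom
          (inclusion ΔI ΔJ K p q (n + 1) h (x ⊗ₜ y)) =
          (HomologicalComplex.mapBifunctor.d₁ (chainComplex K ΔI)
            (chainComplex K ΔJ) (MonoidalCategory.curriedTensor (ModuleCat.{u} K))
            (ComplexShape.down ℕ) p q n).hom (x ⊗ₜ y) +
          (HomologicalComplex.mapBifunctor.d₂ (chainComplex K ΔI)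
            (chainComplex K ΔJ) (MonoidalCategory.curriedTensor (ModuleCat.{u} K))
            (ComplexShape.down ℕ) p q n).hom (x ⊗ₜ y) := by
        have h1 : HomologicalComplex.ιTensorObj (chainComplex K ΔI) (chainComplex K ΔJ) p q
            (n + 1) h ≫ (tensorComplex ΔI ΔJ K).d (n + 1) n =
            HomologicalComplex.mapBifunctor.d₁ (chainComplex K ΔI) (chainComplex K ΔJ)
              (MonoidalCategory.curriedTensor (ModuleCat.{u} K)) (ComplexShape.down ℕ) p q n +
            HomologicalComplex.mapBifunctor.d₂ (chainComplex K ΔI) (chainComplex K ΔJ)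
              (MonoidalCategory.curriedTensor (ModuleCat.{u} K)) (ComplexShape.down ℕ) p q n := by
          rw [HomologicalComplex.mapBifunctor.d_eq, Preadditive.comp_add,
            HomologicalComplex.mapBifunctor.ι_D₁, HomologicalComplex.mapBifunctor.ι_D₂]
        exact congrArg (fun f => f.hom (x ⊗ₜ y)) h1
      change matrixMap _ (tensorToJoin ΔI ΔJ K (n + 1)
          (inclusion ΔI ΔJ K p q (n + 1) h (x ⊗ₜ y))) ρ =
        tensorToJoin ΔI ΔJ K n (((tensorComplex ΔI ΔJ K).d (n + 1) n).hom
          (inclusion ΔI ΔJ K p q (n + 1) h (x ⊗ₜ y))) ρ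
      rw [hd, map_add, Finsupp.add_apply, tensorToJoin_d₁ ΔI ΔJ h, tensorToJoin_d₂ ΔI ΔJ h,
        tensorToJoin_inclusion, ← bd_extend_joinMap ΔI ΔJ h, joinFace_joinEquiv_symm,
        ← extend_matrixMap, extend_apply])

end MonRes

end

theorem mainTheorem5 {K : Type*} [Field K] {n r s : ℕ}
    (I J : Ideal (MvPolynomial (Fin n) K)) (hIJ : I ⊓ J = I * J)
    (mI : Fin r → (Fin n →₀ ℕ)) (mJ : Fin s → (Fin n →₀ ℕ))
    (ΔI : AbstractSimplicialComplex (Fin r)) (ΔJ : AbstractSimplicialComplex (Fin s))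
    (hI : MonRes.MinimalResolutionSupportedBy I mI ΔI)
    (hJ : MonRes.MinimalResolutionSupportedBy J mJ ΔJ) :
    MonRes.MinimalResolutionSupportedBy (I ⊔ J) (Fin.append mI mJ) (MonRes.join ΔI ΔJ) ∧
      Nonempty (MonoidalCategory.tensorObj (MonRes.chainComplex K ΔI) (MonRes.chainComplex K ΔJ) ≅
        MonRes.chainComplex K (MonRes.join ΔI ΔJ)) :=
  ⟨hI.join hIJ hJ, ⟨MonRes.tensorIsoJoin ΔI ΔJ K⟩⟩
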